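/- **Setting.** Let $d,T\in\mathbb N$, let $(\Omega,\mathcal F,(\mathcal F_t)_{0\le t\le T},\mathbb P)$ be a filtered probability space such that $\mathcal F_0$ contains all $\mathbb P$-null sets, and let $\mathcal S$ be a non-empty family of adapted $\mathbb R^d$-valued processes (the possible discounted price processes). Write $\Delta S_t=S_t-S_{t-1}$. A strategy is $\phi=(\phi_1,\dots,\phi_T)$ with each $\phi_t$ an $\mathcal F_{t-1}$-measurable $\mathbb R^d$-valued random variable, and its wealth under $S\in\mathcal S$ from initial capital $w$ is $W^S_t(w,\phi)=w+\sum_{s=1}^t\langle\phi_s,\Delta S_s\rangle$. Let $\mathcal L(w,S)$ be the set of strategies with $W^S_t(w,\phi)\ge 0$ a.s. for all $t\in\{0,\dots,T\}$, and let $\mathcal A(w)=\bigcap_{S\in\mathcal S}\mathcal L(w,S)$ be the set of admissible strategies. For $S\in\mathcal S$ and $t\in\{1,\dots,T\}$ let $D^S_t(\omega)$ be the smallest affine subspace of $\mathbb R^d$ containing the support of the regular conditional distribution of $\Delta S_t$ given $\mathcal F_{t-1}$ at $\omega$. Let $\mathcal S^*$ be the set of $S^*\in\mathcal S$ such that * for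 all $\phi\in\mathcal L(w,S^*)$, if $W^{S^*}_T(0,\phi)\ge0$ a.s. then $W^{S^*}_T(0,\phi)=0$ a.s. (no arbitrage), and * $D^S_t\subseteq D^{S^*}_t$ a.s. for all $S\in\mathcal S$ and $t\in\{1,\dots,T\}$. Let $U:\mathbb R\to\mathbb R\cup\{-\infty\}$ be non-decreasing, concave and upper semicontinuous, and suppose that the interior of $\{x: U(x)>-\infty\}$ is $(0,\infty)$; $U$ may be unbounded above. Define $$u(w)=\sup_{\varphi\in\mathcal A(w)}\ \inf_{S\in\mathcal S}\ \mathbb E\big[U(W^S_T(w,\varphi))\big],$$ where an expectation whose positive and negative parts are both infinite is $-\infty$. Let $\mathcal W$ be the set of $\mathcal F_T$-measurable real random variables $X$ with $\mathbb E[|X|^p]<\infty$ for all $p>0$. **Theorem.** Let $w>0$. Assume that $\|\Delta S_t\|\in\mathcal W$ for all $S\in\mathcal S$ and $t\in\{1,\dots,T\}$, and that for some $S^*\in\mathcal S^*$ there are, for every $t\in\{1,\dots,T\}$, $\mathcal F_{t-1}$-measurable, a.s. positive random variables $\beta_t,\kappa_t$ with $1/\beta_t\in\mathcal W$ and $$\operatorname*{ess\,inf}_{\xi}\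 \mathbb P\big(\langle\xi,\Delta S^*_t\rangle\le-\beta_t\|\xi\|\ \big|\ \mathcal F_{t-1}\big)\ \ge\ \kappa_t\quad\text{a.s. on }\{D^{S^*}_t\neq\{0\}\},$$ the essential infimum being over all $\mathcal F_{t-1}$-measurable $\xi$ with $\xi\in D^{S^*}_t$ a.s. Then there is $\varphi^*\in\mathcal A(w)$ with $$u(w)=\inf_{S\in\mathcal S}\mathbb E\big[U(W^S_T(w,\varphi^*))\big],$$ and $u(w)$ is finite: $-\infty<u(w)<+\infty$. -/

import Mathlib

open MeasureTheory ProbabilityTheory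

noncomputable section

namespace RobustUtility

variable {Ω : Type*} {mΩ : MeasurableSpace Ω} {d : ℕ}

/-- A price process, or a trading strategy, in `ℝᵈ`.  Only finitely many times enter below: for a
horizon `T`, a price process `S` is used at the times `0, …, T`, and a strategy `φ` at the indices
`0, …, T - 1`, where `φ t` is the portfolio held over the trading period from `t` to `t + 1`
(often written `φ_{t+1}`). -/
abbrev RandomPath (Ω : Type*) (d : ℕ) : Type _ := ℕ → Ω → EuclideanSpace ℝ (Fin d)

/-- The price change `S_{t+1} - S_t` over the trading period from `t` to `t + 1`. -/
def priceChange (S : RandomPath Ω d) (t : ℕ) (ω : Ω) : EuclideanSpace ℝ (Fin d) :=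
  S (t + 1) ω - S t ω

/-- The wealth at time `t` of the self-financing portfolio `φ` with initial capital `w`, when
prices evolve according to `S`. -/
def wealth (w : ℝ) (S φ : RandomPath Ω d) (t : ℕ) (ω : Ω) : ℝ :=
  w + ∑ s ∈ Finset.range t, inner ℝ (φ s ω) (priceChange S s ω)

/-- Trading strategies: the portfolio for the period from `t` to `t + 1` is chosen at time `t`. -/
def strategies (ℱ : Filtration ℕ mΩ) (T : ℕ) : Set (RandomPath Ω d) :=
  {φ | ∀ t < T, Measurable[ℱ t] (φ t)}

/-- Strategies that are feasible for the price process `S`: the wealth never becomes negative. -/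
def feasible (μ : Measure Ω) (ℱ : Filtration ℕ mΩ) (T : ℕ) (w : ℝ) (S : RandomPath Ω d) :
    Set (RandomPath Ω d) :=
  {φ | φ ∈ strategies ℱ T ∧ ∀ t ≤ T, ∀ᵐ ω ∂μ, 0 ≤ wealth w S φ t ω}

/-- Admissible strategies: feasible for every possible price process. -/
def admissible (μ : Measure Ω) (ℱ : Filtration ℕ mΩ) (T : ℕ) (w : ℝ) (𝒮 : Set (RandomPath Ω d)) :
    Set (RandomPath Ω d) :=
  ⋂ S ∈ 𝒮, feasible μ ℱ T w S

/-- The regular conditional distribution of `X` with respect to the sub-σ-algebra `m`. -/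
def condLaw (μ : Measure Ω) [IsFiniteMeasure μ] (m : MeasurableSpace Ω)
    (X : Ω → EuclideanSpace ℝ (Fin d)) (ω : Ω) : Measure (EuclideanSpace ℝ (Fin d)) :=
  (@condDistrib Ω Ω (EuclideanSpace ℝ (Fin d)) _ _ _ mΩ m X id μ _) ω

/-- The smallest affine subspace containing the support of the conditional law given `ℱ t` of the
price change from `t` to `t + 1`. -/
def condSpan (μ : Measure Ω) [IsFiniteMeasure μ] (ℱ : Filtration ℕ mΩ) (S : RandomPath Ω d)
    (t : ℕ) (ω : Ω) : AffineSubspace ℝ (EuclideanSpace ℝ (Fin d)) :=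
  affineSpan ℝ (condLaw μ (ℱ t) (priceChange S t) ω).support

/-- Absence of arbitrage for the single price process `S`. -/
def NoArbitrage (μ : Measure Ω) (ℱ : Filtration ℕ mΩ) (T : ℕ) (w : ℝ) (S : RandomPath Ω d) : Prop :=
  ∀ φ ∈ feasible μ ℱ T w S,
    (∀ᵐ ω ∂μ, 0 ≤ wealth 0 S φ T ω) → ∀ᵐ ω ∂μ, wealth 0 S φ T ω = 0

/-- The possible price processes `S*` that are free of arbitrage and whose redundant assets are
redundant for all other possible price processes as well. -/
def arbitrageFreeModels (μ : Measure Ω) [IsFiniteMeasure μ] (ℱ : Filtration ℕ mΩ) (T : ℕ) (w : ℝ)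
    (𝒮 : Set (RandomPath Ω d)) : Set (RandomPath Ω d) :=
  {S' | S' ∈ 𝒮 ∧ NoArbitrage μ ℱ T w S' ∧
    ∀ S ∈ 𝒮, ∀ t < T, ∀ᵐ ω ∂μ, condSpan μ ℱ S t ω ≤ condSpan μ ℱ S' t ω}

/-- The quantitative form of absence of arbitrage over the period from `t` to `t + 1`: `β` and `κ`
are `ℱ t`-measurable, almost surely positive, and almost surely on `{D ≠ {0}}`, with
`D = condSpan μ ℱ S t`, the essential infimum over all `ℱ t`-measurable selections `ξ` of `D` of the
conditional probabilities `P(⟪ξ, ΔS⟫ ≤ -β ‖ξ‖ | ℱ t)` is at least `κ`.  (An essential infimum is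
a greatest almost sure lower bound, so this says that `κ` is an almost sure lower bound for each
`ξ`.) -/
def IsArbitrageBound (μ : Measure Ω) [IsFiniteMeasure μ] (ℱ : Filtration ℕ mΩ) (S : RandomPath Ω d)
    (t : ℕ) (β κ : Ω → ℝ) : Prop :=
  Measurable[ℱ t] β ∧ Measurable[ℱ t] κ ∧ (∀ᵐ ω ∂μ, 0 < β ω) ∧ (∀ᵐ ω ∂μ, 0 < κ ω) ∧
    ∀ ξ : Ω → EuclideanSpace ℝ (Fin d), Measurable[ℱ t] ξ →
      (∀ᵐ ω ∂μ, ξ ω ∈ condSpan μ ℱ S t ω) →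
      ∀ᵐ ω ∂μ, (condSpan μ ℱ S t ω : Set (EuclideanSpace ℝ (Fin d))) ≠ {0} →
        κ ω ≤ (μ⟦{ω' | inner ℝ (ξ ω') (priceChange S t ω') ≤ -β ω' * ‖ξ ω'‖} | ℱ t⟧) ω

/-- Real random variables, measurable with respect to `m`, with finite moments of all orders. -/
def finiteMoments (μ : Measure Ω) (m : MeasurableSpace Ω) : Set (Ω → ℝ) :=
  {X | Measurable[m] X ∧ ∀ p : ℝ, 0 < p → Integrable (fun ω => |X ω| ^ p) μ}

/-- Utility functions `ℝ → ℝ ∪ {-∞}`: non-decreasing, concave and upper semicontinuous. -/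
structure IsUtility (U : ℝ → EReal) : Prop where
  ne_top : ∀ x, U x ≠ ⊤
  mono : Monotone U
  concave : ∀ x y a b : ℝ, 0 < a → 0 < b → a + b = 1 →
    (a : EReal) * U x + (b : EReal) * U y ≤ U (a * x + b * y)
  usc : UpperSemicontinuous U

/-- The effective domain of a utility function. -/
def effDomain (U : ℝ → EReal) : Set ℝ := {x | U x ≠ ⊥}

/-- The expectation of an extended-real random variable, as the expectation of the positive part
minus that of the negative part, with `∞ - ∞ = -∞` (which is also the convention of `EReal`). -/
def expectation (μ : Measure Ω) (X : Ω → EReal) : EReal :=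
  ((∫⁻ ω, (X ω).toENNReal ∂μ : ENNReal) : EReal) - ((∫⁻ ω, (-X ω).toENNReal ∂μ : ENNReal) : EReal)

/-- Worst-case expected utility of the terminal wealth of `φ`. -/
def worstCaseUtility (μ : Measure Ω) (T : ℕ) (w : ℝ) (𝒮 : Set (RandomPath Ω d)) (U : ℝ → EReal)
    (φ : RandomPath Ω d) : EReal :=
  ⨅ S ∈ 𝒮, expectation μ (fun ω => U (wealth w S φ T ω))

/-- The value of the robust utility maximisation problem. -/
def robustValue (μ : Measure Ω) (ℱ : Filtration ℕ mΩ) (T : ℕ) (w : ℝ) (𝒮 : Set (RandomPath Ω d))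
    (U : ℝ → EReal) : EReal :=
  ⨆ φ ∈ admissible μ ℱ T w 𝒮, worstCaseUtility μ T w 𝒮 U φ

end RobustUtility

end

/-! Fix the arbitrage-free model `S'`. Replacing each portfolio by its orthogonal projection onto
the conditional span of `S'` changes the wealth in no model (`exists_strategy_mem_condSpan`). A
projected feasible strategy satisfies `β t * ‖φ t‖ ≤ wealth t` under `S'`: otherwise, with
conditional probability at least `κ t > 0`, the next wealth would be negative
(`IsArbitrageBound.mul_norm_le_wealth`). Iterating bounds all relevant strategies by one sequence
`G` in L², built from products of `1 + ‖ΔS'‖ / β`. As `U` grows at most linearly, the value is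
finite from above; holding cash bounds it from below.

For existence, the strategies dominated by `G` with worst-case utility at least `r` form a bounded,
closed, convex subset of an L² space. Closedness comes from Fatou's lemma applied to the
non-negative function `C (1 + x) - U x`, the affine part converging by domination
(`le_expectation_of_tendsto`). As `r` increases to the value, these sets decrease and have a common
point (`nonempty_iInter_of_convex_of_bounded`), which is optimal. The projections are measurable
because they are limits of ergodic averages (`exists_measurable_projection`). -/

noncomputable section

namespace RobustUtility

open Filter Topology
open scoped ENNReal

/-! ### Measurable orthogonal projections through the mean ergodic theorem. -/

section Projection

variable {V : Type*} [NormedAddCommGroup V] [InnerProductSpace ℝ V]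

/-- The operator `v ↦ v - ⟪g, v⟫ g`, a contraction when `‖g‖ ≤ 1`. -/
def deflation (g : V) : V →L[ℝ] V :=
  ContinuousLinearMap.id ℝ V - (innerSL ℝ g).smulRight g

theorem deflation_apply (g v : V) : deflation g v = v - inner ℝ g v • g := by
  simp [deflation]

theorem norm_deflation_le {g : V} (hg : ‖g‖ ≤ 1) : ‖deflation g‖ ≤ 1 := by
  refine ContinuousLinearMap.opNorm_le_bound _ zero_le_one fun v => ?_
  rw [one_mul, deflation_apply]
  -- After squaring, the left side is `‖v‖² - (2 - ‖g‖²) ⟪g, v⟫²`.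
  refine abs_le_of_sq_le_sq' ?_ (norm_nonneg _) |>.2
  rw [norm_sub_sq_real, norm_smul, inner_smul_right, real_inner_comm, mul_pow, Real.norm_eq_abs,
    sq_abs]
  have h1 : ‖g‖ ^ 2 ≤ 1 := pow_le_one₀ (norm_nonneg _) hg
  nlinarith [mul_le_mul_of_nonneg_left h1 (sq_nonneg (inner ℝ g v))]

theorem continuous_deflation : Continuous (deflation : V → V →L[ℝ] V) := by
  unfold deflation
  fun_prop

variable {E : Type*} [MeasurableSpace E] [FiniteDimensional ℝ V] [MeasurableSpace V] [BorelSpace V]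
  {g : E → V}

theorem integrable_deflation (ν : Measure E) [IsFiniteMeasure ν] (hg : Measurable g)
    (hg1 : ∀ x, ‖g x‖ ≤ 1) : Integrable (fun x => deflation (g x)) ν := by
  refine Integrable.of_bound (C := 1) ?_ (ae_of_all _ fun x => norm_deflation_le (hg1 x))
  exact continuous_deflation.comp_aestronglyMeasurable hg.aestronglyMeasurable

/-- Pairing the averaged operator with `v` gives `‖v‖² - ∫ ⟪g, v⟫²`, so a fixed vector forces the
integral of the square to vanish. -/
theorem integral_deflation_apply_eq_self_iff (ν : Measure E) [IsProbabilityMeasure ν]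
    (hg : Measurable g) (hg1 : ∀ x, ‖g x‖ ≤ 1) (v : V) :
    (∫ x, deflation (g x) ∂ν) v = v ↔ ∀ᵐ x ∂ν, inner ℝ (g x) v = 0 := by
  have hi := integrable_deflation ν hg hg1
  rw [ContinuousLinearMap.integral_apply hi]
  have hi' := hi.apply_continuousLinearMap v
  constructor
  · intro h
    have h2 : ∫ x, inner ℝ v (deflation (g x) v) ∂ν = inner ℝ v v := by
      rw [integral_inner hi', h]
    have h3 : ∀ x, inner ℝ v (deflation (g x) v) = inner ℝ v v - (inner ℝ (g x) v) ^ 2 := by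
      intro x
      rw [deflation_apply, inner_sub_right, inner_smul_right, real_inner_comm (g x) v, sq]
    have hint : Integrable (fun x => (inner ℝ (g x) v : ℝ) ^ 2) ν := by
      refine (((integrable_const (inner ℝ v v)).sub (hi'.const_inner v))).congr
        (ae_of_all _ fun x => ?_)
      simp [h3]
    simp_rw [h3] at h2
    rw [integral_sub (integrable_const _) hint] at h2
    simp only [integral_const, probReal_univ, one_smul, sub_eq_self] at h2
    rw [integral_eq_zero_iff_of_nonneg (fun x => sq_nonneg _) hint] at h2
    filter_upwards [h2] with x hx
    simpa using hx
  · intro h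
    rw [integral_congr_ae (g := fun _ => v)]
    · simp
    · filter_upwards [h] with x hx
      simp [deflation_apply, hx]

/-- The averaged deflation is a contraction whose fixed space is the space to project onto. By von
Neumann's ergodic theorem the averages of its iterates converge to the projection, and each iterate
is measurable in `ω` as an integral against the kernel. No measurable choice of a basis is needed.
-/
theorem exists_measurable_projection_of_norm_le_one {Ω : Type*} {mΩ : MeasurableSpace Ω} (κ : Kernel Ω E)
    [IsMarkovKernel κ] (hg : Measurable g) (hg1 : ∀ x, ‖g x‖ ≤ 1) {φ : Ω → V}
    (hφ : Measurable φ) :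
    ∃ π : Ω → V, Measurable π ∧ ∀ ω, (∀ᵐ x ∂κ ω, inner ℝ (g x) (π ω) = 0) ∧
      ∀ u, (∀ᵐ x ∂κ ω, inner ℝ (g x) u = 0) → inner ℝ u (φ ω - π ω) = 0 := by
  set F : Ω → V →L[ℝ] V := fun ω => ∫ x, deflation (g x) ∂κ ω with hF
  have hF1 : ∀ ω, ‖F ω‖ ≤ 1 := fun ω => by
    simpa using norm_integral_le_of_norm_le_const (μ := κ ω) (C := 1)
      (ae_of_all _ fun x => norm_deflation_le (hg1 x))
  set K : Ω → Submodule ℝ V := fun ω => (F ω).eqLocus (1 : V →L[ℝ] V)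
  have hK : ∀ ω v, v ∈ K ω ↔ ∀ᵐ x ∂κ ω, inner ℝ (g x) v = 0 := fun ω v => by
    rw [← integral_deflation_apply_eq_self_iff (κ ω) hg hg1 v]
    rfl
  have hmeas : ∀ n : ℕ, Measurable fun ω => (F ω)^[n] (φ ω) := by
    intro n
    induction n with
    | zero => simpa using hφ
    | succ n ih =>
      simp_rw [Function.iterate_succ_apply']
      have : ∀ ω, (F ω) ((F ω)^[n] (φ ω)) = ∫ x, (fun ω x => (F ω)^[n] (φ ω) -
          inner ℝ (g x) ((F ω)^[n] (φ ω)) • g x) ω x ∂κ ω := by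
        intro ω
        simp_rw [hF, ContinuousLinearMap.integral_apply (integrable_deflation (κ ω) hg hg1),
          deflation_apply]
      simp_rw [this]
      refine (StronglyMeasurable.integral_kernel_prod_right (κ := κ) ?_).measurable
      apply Measurable.stronglyMeasurable
      have h1 : Measurable fun p : Ω × E => (F p.1)^[n] (φ p.1) := ih.comp measurable_fst
      have h2 : Measurable fun p : Ω × E => g p.2 := hg.comp measurable_snd
      exact h1.sub ((h2.inner h1).smul h2)
  refine ⟨fun ω => (K ω).orthogonalProjectionOnto (φ ω), ?_, fun ω => ⟨?_, fun u hu => ?_⟩⟩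
  · refine measurable_of_tendsto_metrizable (f := fun n ω => birkhoffAverage ℝ (F ω) id n (φ ω))
      (fun n => ?_) ?_
    · simp only [birkhoffAverage, birkhoffSum, id]
      exact (Finset.measurable_fun_sum _ fun i _ => hmeas i).const_smul _
    · rw [tendsto_pi_nhds]
      exact fun ω => (F ω).tendsto_birkhoffAverage_orthogonalProjection (hF1 ω) (φ ω)
  · exact (hK ω _).1 (Submodule.coe_mem _)
  · rw [real_inner_comm]
    exact (K ω).starProjection_inner_eq_zero (φ ω) u ((hK ω u).2 hu)

/-- The orthogonal projections of `φ ω` onto the spaces of vectors that are orthogonal to `g`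
almost everywhere with respect to `κ ω` depend measurably on `ω`. -/
theorem exists_measurable_projection {Ω : Type*} {mΩ : MeasurableSpace Ω} (κ : Kernel Ω E)
    [IsMarkovKernel κ] (hg : Measurable g) {φ : Ω → V} (hφ : Measurable φ) :
    ∃ π : Ω → V, Measurable π ∧ ∀ ω, (∀ᵐ x ∂κ ω, inner ℝ (g x) (π ω) = 0) ∧
      ∀ u, (∀ᵐ x ∂κ ω, inner ℝ (g x) u = 0) → inner ℝ u (φ ω - π ω) = 0 := by
  -- Dividing `g` by `1 + ‖g‖` makes it bounded by 1 and preserves orthogonality to it.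
  have hpos : ∀ x, 0 < 1 + ‖g x‖ := fun x => by positivity
  obtain ⟨π, hπ, h⟩ := exists_measurable_projection_of_norm_le_one
    (g := fun x => (1 + ‖g x‖)⁻¹ • g x) κ ((measurable_const.add hg.norm).inv.smul hg)
    (fun x => by
      rw [norm_smul, norm_inv, Real.norm_of_nonneg (hpos x).le, inv_mul_le_iff₀ (hpos x)]
      linarith) hφ
  refine ⟨π, hπ, ?_⟩
  simpa only [inner_smul_left, RCLike.conj_to_real, mul_eq_zero, inv_eq_zero, (hpos _).ne',
    false_or] using h

end Projection

/-! ### Nested bounded closed convex sets in a Hilbert space. -/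

section Hilbert

/-- A decreasing sequence of non-empty closed convex subsets of a ball of a Hilbert space has a
common point. -/
theorem nonempty_iInter_of_convex_of_bounded {H : Type*} [NormedAddCommGroup H]
    [InnerProductSpace ℝ H] [CompleteSpace H] {C : ℕ → Set H} (hanti : Antitone C)
    (hconv : ∀ n, Convex ℝ (C n)) (hclosed : ∀ n, IsClosed (C n)) (hne : ∀ n, (C n).Nonempty)
    {R : ℝ} (hR : ∀ n, ∀ x ∈ C n, ‖x‖ ≤ R) : (⋂ n, C n).Nonempty := by
  -- The point of least norm, with its variational inequality.
  have hmin : ∀ n, ∃ v ∈ C n, ∀ w ∈ C n, ‖v‖ ^ 2 ≤ inner ℝ v w := by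
    intro n
    obtain ⟨v, hv, h⟩ := exists_norm_eq_iInf_of_complete_convex (hne n) (hclosed n).isComplete
      (hconv n) 0
    refine ⟨v, hv, fun w hw => ?_⟩
    have := (norm_eq_iInf_iff_real_inner_le_zero (hconv n) hv).1 h w hw
    simp only [zero_sub, inner_neg_left, inner_sub_right, real_inner_self_eq_norm_sq] at this
    linarith
  choose v hv hvw using hmin
  -- The squared norms increase and are bounded, hence converge; this estimate turns that into the
  -- Cauchy property.
  have hdist : ∀ m n, m ≤ n → ‖v n - v m‖ ^ 2 ≤ ‖v n‖ ^ 2 - ‖v m‖ ^ 2 := by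
    intro m n hmn
    have := hvw m (v n) (hanti hmn (hv n))
    rw [norm_sub_sq_real, real_inner_comm]
    linarith
  have hmono : Monotone fun n => ‖v n‖ ^ 2 := fun m n hmn => by
    have := hdist m n hmn
    have := sq_nonneg ‖v n - v m‖
    simp only
    linarith
  have hbdd : BddAbove (Set.range fun n => ‖v n‖ ^ 2) :=
    ⟨R ^ 2, Set.forall_mem_range.2 fun n => pow_le_pow_left₀ (norm_nonneg _) (hR n _ (hv n)) 2⟩
  have hlim := tendsto_atTop_ciSup hmono hbdd
  set l := ⨆ n, ‖v n‖ ^ 2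
  have hcau : CauchySeq v := by
    refine cauchySeq_of_le_tendsto_0' (fun n => √(l - ‖v n‖ ^ 2)) (fun n m hnm => ?_) ?_
    · rw [dist_comm, dist_eq_norm]
      refine Real.le_sqrt_of_sq_le ((hdist n m hnm).trans ?_)
      have := le_ciSup hbdd m
      linarith
    · have := (tendsto_const_nhds (x := l)).sub hlim
      rw [sub_self] at this
      simpa using this.sqrt
  obtain ⟨x, hx⟩ := cauchySeq_tendsto_of_complete hcau
  refine ⟨x, Set.mem_iInter.2 fun n => (hclosed n).mem_of_tendsto hx ?_⟩
  filter_upwards [eventually_ge_atTop n] with m hm using hanti hm (hv m)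

end Hilbert

/-! ### Concave utilities and the closedness of superlevel sets of expected utility. -/

section Utility

variable {U : ℝ → EReal}

theorem IsUtility.ne_bot_of_pos (hdom : interior (effDomain U) = Set.Ioi 0) {x : ℝ} (hx : 0 < x) :
    U x ≠ ⊥ := by
  have : x ∈ interior (effDomain U) := by rw [hdom]; exact hx
  exact interior_subset this

theorem IsUtility.eq_bot_of_neg (hU : IsUtility U) (hdom : interior (effDomain U) = Set.Ioi 0)
    {x : ℝ} (hx : x < 0) : U x = ⊥ := by
  by_contra h
  have : Set.Ioi x ⊆ interior (effDomain U) := by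
    refine interior_maximal (fun y hy hb => h ?_) isOpen_Ioi
    exact le_bot_iff.1 ((hU.mono (le_of_lt hy)).trans_eq hb)
  rw [hdom] at this
  have h2 := this (show x / 2 ∈ Set.Ioi x by simp only [Set.mem_Ioi]; linarith)
  simp only [Set.mem_Ioi] at h2
  linarith

/-- A concave utility function grows at most linearly. -/
theorem IsUtility.exists_le_linear (hU : IsUtility U) (hdom : interior (effDomain U) = Set.Ioi 0) :
    ∃ C : ℝ, 0 ≤ C ∧ ∀ x, U x ≤ ((C * (1 + x) : ℝ) : EReal) := by
  have h1 := IsUtility.ne_bot_of_pos hdom one_pos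
  have h2 := IsUtility.ne_bot_of_pos hdom (one_half_pos (α := ℝ))
  obtain ⟨a, ha⟩ : ∃ a : ℝ, U 1 = a := ⟨(U 1).toReal, (EReal.coe_toReal (hU.ne_top _) h1).symm⟩
  obtain ⟨b, hb⟩ : ∃ b : ℝ, U (1 / 2) = b :=
    ⟨(U (1 / 2)).toReal, (EReal.coe_toReal (hU.ne_top _) h2).symm⟩
  refine ⟨2 * (|a| + |b|), by positivity, fun x => ?_⟩
  rcases lt_or_ge x 0 with hx | hx
  · rw [hU.eq_bot_of_neg hdom hx]
    exact bot_le
  have hb0 := abs_nonneg b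
  have ha0 := abs_nonneg a
  rcases le_or_gt x 1 with hx1 | hx1
  · refine (hU.mono hx1).trans ?_
    rw [ha, EReal.coe_le_coe_iff]
    have := le_abs_self a
    nlinarith
  · have hxb := IsUtility.ne_bot_of_pos hdom (zero_lt_one.trans hx1)
    obtain ⟨c, hc⟩ : ∃ c : ℝ, U x = c := ⟨(U x).toReal, (EReal.coe_toReal (hU.ne_top _) hxb).symm⟩
    -- The point `1` is the convex combination of `x` and `1 / 2` with weight `(2x - 1)⁻¹` on `x`.
    -- The base point is `1 / 2` because `U 0` may be `⊥`.
    have hpos : 0 < 2 * x - 1 := by linarith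
    have hθ : 0 < (2 * x - 1)⁻¹ := by positivity
    have hθ1 : (2 * x - 1)⁻¹ < 1 := inv_lt_one_of_one_lt₀ (by linarith)
    have key := hU.concave x (1 / 2) (2 * x - 1)⁻¹ (1 - (2 * x - 1)⁻¹) hθ (by linarith) (by ring)
    have e : (2 * x - 1)⁻¹ * x + (1 - (2 * x - 1)⁻¹) * (1 / 2) = 1 := by field_simp; ring
    rw [e, ha, hb, hc, ← EReal.coe_mul, ← EReal.coe_mul, ← EReal.coe_add,
      EReal.coe_le_coe_iff] at key
    rw [hc, EReal.coe_le_coe_iff]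
    have hle : (2 * x - 1)⁻¹ * c ≤ |a| + |b| := by
      have h3 := le_abs_self a
      have h4 := neg_abs_le b
      nlinarith
    have : c ≤ (2 * x - 1) * (|a| + |b|) := by
      rwa [inv_mul_le_iff₀ hpos] at hle
    nlinarith

/-- The shortfall of the utility `U` with respect to the affine function `x ↦ C (1 + x)`. -/
def shortfall (C : ℝ) (U : ℝ → EReal) (x : ℝ) : ℝ≥0∞ := (((C * (1 + x) : ℝ) : EReal) - U x).toENNReal

theorem shortfall_of_eq_bot {C x : ℝ} (h : U x = ⊥) : shortfall C U x = ∞ := by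
  rw [shortfall, h, EReal.coe_sub_bot, EReal.toENNReal_top]

theorem shortfall_of_eq_coe {C x u : ℝ} (h : U x = u) :
    shortfall C U x = ENNReal.ofReal (C * (1 + x) - u) := by
  rw [shortfall, h, ← EReal.coe_sub, EReal.toENNReal_of_ne_top (EReal.coe_ne_top _),
    EReal.toReal_coe]

theorem IsUtility.eq_bot_or_coe (hU : IsUtility U) (x : ℝ) : U x = ⊥ ∨ ∃ u : ℝ, U x = u := by
  by_cases h : U x = ⊥
  · exact Or.inl h
  · exact Or.inr ⟨(U x).toReal, (EReal.coe_toReal (hU.ne_top _) h).symm⟩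

theorem IsUtility.measurable (hU : IsUtility U) : Measurable U := hU.mono.measurable

theorem measurable_shortfall (hU : IsUtility U) (C : ℝ) : Measurable (shortfall C U) := by
  unfold shortfall
  have := hU.measurable
  have h2 : Measurable fun x : ℝ => ((C * (1 + x) : ℝ) : EReal) :=
    measurable_coe_real_ereal.comp (by fun_prop)
  simp_rw [sub_eq_add_neg]
  fun_prop

/-- Affine minus concave is convex; `hC` ensures that the passage to `ℝ≥0∞` truncates nothing. -/
theorem shortfall_convex (hU : IsUtility U) {C : ℝ}
    (hC : ∀ x, U x ≤ ((C * (1 + x) : ℝ) : EReal)) {a b : ℝ} (ha : 0 < a) (hb : 0 < b)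
    (hab : a + b = 1) (x y : ℝ) :
    shortfall C U (a * x + b * y) ≤
      ENNReal.ofReal a * shortfall C U x + ENNReal.ofReal b * shortfall C U y := by
  rcases hU.eq_bot_or_coe x with hx | ⟨u, hx⟩
  · rw [shortfall_of_eq_bot hx, ENNReal.mul_top (by simpa using ha), top_add]
    exact le_top
  rcases hU.eq_bot_or_coe y with hy | ⟨v, hy⟩
  · rw [shortfall_of_eq_bot hy, ENNReal.mul_top (by simpa using hb), add_top]
    exact le_top
  have key := hU.concave x y a b ha hb hab
  rw [hx, hy, ← EReal.coe_mul, ← EReal.coe_mul, ← EReal.coe_add] at key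
  rcases hU.eq_bot_or_coe (a * x + b * y) with hz | ⟨z, hz⟩
  · rw [hz] at key
    exact absurd (le_bot_iff.1 key) (EReal.coe_ne_bot _)
  rw [hz, EReal.coe_le_coe_iff] at key
  have hu := hC x
  have hv := hC y
  rw [hx, EReal.coe_le_coe_iff] at hu
  rw [hy, EReal.coe_le_coe_iff] at hv
  rw [shortfall_of_eq_coe hx, shortfall_of_eq_coe hy, shortfall_of_eq_coe hz,
    ← ENNReal.ofReal_mul ha.le, ← ENNReal.ofReal_mul hb.le,
    ← ENNReal.ofReal_add (mul_nonneg ha.le (by linarith)) (mul_nonneg hb.le (by linarith))]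
  refine ENNReal.ofReal_le_ofReal ?_
  have : C * (1 + (a * x + b * y)) = a * (C * (1 + x)) + b * (C * (1 + y)) := by
    linear_combination (-C) * hab
  linarith

/-- By upper semicontinuity, `U y < q` persists near `x`, where `C (1 + y) - q` is then a continuous
minorant; `q` is chosen so that it exceeds `c` at `x`. -/
theorem lowerSemicontinuous_shortfall (hU : IsUtility U) (C : ℝ) :
    LowerSemicontinuous (shortfall C U) := by
  intro x c hc
  replace hc : c < shortfall C U x := hc
  have hlt : ∀ y (q : ℝ), U y < q → ENNReal.ofReal (C * (1 + y) - q) ≤ shortfall C U y := by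
    intro y q hq
    rcases hU.eq_bot_or_coe y with hy | ⟨u, hy⟩
    · rw [shortfall_of_eq_bot hy]; exact le_top
    · rw [shortfall_of_eq_coe hy]
      rw [hy, EReal.coe_lt_coe_iff] at hq
      exact ENNReal.ofReal_le_ofReal (by linarith)
  have hct : c ≠ ∞ := ne_top_of_lt hc
  obtain ⟨q, hq1, hq2⟩ : ∃ q : ℝ, U x < q ∧ c < ENNReal.ofReal (C * (1 + x) - q) := by
    rcases hU.eq_bot_or_coe x with hx | ⟨u, hx⟩
    · refine ⟨C * (1 + x) - (c.toReal + 1), by rw [hx]; exact EReal.bot_lt_coe _, ?_⟩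
      rw [sub_sub_cancel, ENNReal.lt_ofReal_iff_toReal_lt hct]
      linarith
    · rw [shortfall_of_eq_coe hx, ENNReal.lt_ofReal_iff_toReal_lt hct] at hc
      refine ⟨u + (C * (1 + x) - u - c.toReal) / 2, ?_, ?_⟩
      · rw [hx, EReal.coe_lt_coe_iff]; linarith
      · rw [ENNReal.lt_ofReal_iff_toReal_lt hct]; linarith
  have hcont : Continuous fun y => ENNReal.ofReal (C * (1 + y) - q) :=
    ENNReal.continuous_ofReal.comp (by fun_prop)
  filter_upwards [hU.usc x q hq1, hcont.continuousAt.eventually (lt_mem_nhds hq2)] with y h1 h2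
  exact h2.trans_le (hlt y q h1)

variable {Ω : Type*} {mΩ : MeasurableSpace Ω} {μ : Measure Ω} {W : Ω → ℝ}

/-- The expected utility of a non-negative integrable random variable, in terms of the shortfall. -/
theorem expectation_eq_sub_shortfall (hU : IsUtility U) {C : ℝ} (hC0 : 0 ≤ C)
    (hC : ∀ x, U x ≤ ((C * (1 + x) : ℝ) : EReal)) [IsFiniteMeasure μ] (hW : Integrable W μ)
    (hW0 : ∀ᵐ ω ∂μ, 0 ≤ W ω) :
    expectation μ (fun ω => U (W ω)) =
      ((∫ ω, C * (1 + W ω) ∂μ : ℝ) : EReal) - ((∫⁻ ω, shortfall C U (W ω) ∂μ : ℝ≥0∞) : EReal) := by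
  have hWm := hW.aemeasurable
  have hUW : AEMeasurable (fun ω => U (W ω)) μ := hU.measurable.comp_aemeasurable hWm
  have hLi : Integrable (fun ω => C * (1 + W ω)) μ := ((integrable_const 1).add hW).const_mul C
  have hL0 : 0 ≤ᵐ[μ] fun ω => C * (1 + W ω) := by
    filter_upwards [hW0] with ω h
    simp only [Pi.zero_apply]
    positivity
  set P := ∫⁻ ω, (U (W ω)).toENNReal ∂μ with hP
  set N := ∫⁻ ω, (-U (W ω)).toENNReal ∂μ with hN
  set Y := ∫⁻ ω, shortfall C U (W ω) ∂μ with hY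
  set x := ∫ ω, C * (1 + W ω) ∂μ with hx
  have hx0 : 0 ≤ x := integral_nonneg_of_ae hL0
  have hX : ∫⁻ ω, ENNReal.ofReal (C * (1 + W ω)) ∂μ = ENNReal.ofReal x :=
    (ofReal_integral_eq_lintegral_ofReal hLi hL0).symm
  have hPle : P ≤ ENNReal.ofReal x := by
    rw [← hX]
    refine lintegral_mono fun ω => ?_
    calc (U (W ω)).toENNReal ≤ ((C * (1 + W ω) : ℝ) : EReal).toENNReal :=
          EReal.toENNReal_le_toENNReal (hC _)
      _ = _ := by rw [EReal.toENNReal_of_ne_top (EReal.coe_ne_top _), EReal.toReal_coe]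
  have hPt : P ≠ ∞ := ne_top_of_le_ne_top ENNReal.ofReal_ne_top hPle
  -- The additive form of the claim avoids `∞ - ∞`: pointwise, both sides are `∞` where `U = ⊥`.
  -- Since `P` is finite, `Y` and `N` can only be infinite together.
  have hsum : Y + P = ENNReal.ofReal x + N := by
    rw [← hX, hY, hP, hN, ← lintegral_add_right' _ hUW.ereal_toENNReal,
      ← lintegral_add_left' (by fun_prop)]
    refine lintegral_congr_ae ?_
    filter_upwards [hL0] with ω h0
    simp only [Pi.zero_apply] at h0
    rcases hU.eq_bot_or_coe (W ω) with hb | ⟨u, hu⟩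
    · simp [shortfall_of_eq_bot hb, hb]
    · have hle := hC (W ω)
      rw [hu, EReal.coe_le_coe_iff] at hle
      rw [shortfall_of_eq_coe hu, hu, ← EReal.coe_neg,
        EReal.toENNReal_of_ne_top (EReal.coe_ne_top _), EReal.toReal_coe,
        EReal.toENNReal_of_ne_top (EReal.coe_ne_top _), EReal.toReal_coe]
      rcases le_total 0 u with h | h
      · rw [ENNReal.ofReal_of_nonpos (by linarith : -u ≤ 0), add_zero,
          ← ENNReal.ofReal_add (by linarith) h, sub_add_cancel]
      · rw [ENNReal.ofReal_of_nonpos h, add_zero, ← ENNReal.ofReal_add h0 (by linarith),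
          sub_eq_add_neg]
  rw [expectation, ← hP, ← hN]
  by_cases hNt : N = ∞
  · have hYt : Y = ∞ := by
      rw [hNt, add_top] at hsum
      exact (ENNReal.add_eq_top.1 hsum).resolve_right hPt
    rw [hNt, hYt, EReal.coe_ennreal_top, EReal.sub_top, EReal.sub_top]
  · have hYt : Y ≠ ∞ := by
      intro h
      rw [h, top_add] at hsum
      exact (ENNReal.add_ne_top.2 ⟨ENNReal.ofReal_ne_top, hNt⟩) hsum.symm
    have := congrArg ENNReal.toReal hsum
    rw [ENNReal.toReal_add hYt hPt, ENNReal.toReal_add ENNReal.ofReal_ne_top hNt,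
      ENNReal.toReal_ofReal hx0] at this
    rw [← EReal.coe_ennreal_toReal hPt, ← EReal.coe_ennreal_toReal hNt,
      ← EReal.coe_ennreal_toReal hYt, ← EReal.coe_sub, ← EReal.coe_sub, EReal.coe_eq_coe_iff]
    linarith

/-- Superlevel sets of the expected utility. -/
theorem le_expectation_iff (hU : IsUtility U) {C : ℝ} (hC0 : 0 ≤ C)
    (hC : ∀ x, U x ≤ ((C * (1 + x) : ℝ) : EReal)) [IsFiniteMeasure μ] (hW : Integrable W μ)
    (hW0 : ∀ᵐ ω ∂μ, 0 ≤ W ω) (r : ℝ) :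
    (r : EReal) ≤ expectation μ (fun ω => U (W ω)) ↔
      r ≤ ∫ ω, C * (1 + W ω) ∂μ ∧
      ∫⁻ ω, shortfall C U (W ω) ∂μ ≤ ENNReal.ofReal (∫ ω, C * (1 + W ω) ∂μ - r) := by
  rw [expectation_eq_sub_shortfall hU hC0 hC hW hW0]
  by_cases h : ∫⁻ ω, shortfall C U (W ω) ∂μ = ∞
  · simp [h]
  · rw [← EReal.coe_ennreal_toReal h, ← EReal.coe_sub, EReal.coe_le_coe_iff]
    have h0 : 0 ≤ (∫⁻ ω, shortfall C U (W ω) ∂μ).toReal := ENNReal.toReal_nonneg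
    -- The first conjunct keeps `ENNReal.ofReal` from truncating a negative number to 0.
    constructor
    · intro h1
      exact ⟨by linarith, (ENNReal.le_ofReal_iff_toReal_le h (by linarith)).2 (by linarith)⟩
    · rintro ⟨h1, h2⟩
      rw [ENNReal.le_ofReal_iff_toReal_le h (by linarith)] at h2
      linarith

theorem expectation_le (hU : IsUtility U) {C : ℝ} (hC0 : 0 ≤ C)
    (hC : ∀ x, U x ≤ ((C * (1 + x) : ℝ) : EReal)) [IsFiniteMeasure μ] (hW : Integrable W μ)
    (hW0 : ∀ᵐ ω ∂μ, 0 ≤ W ω) :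
    expectation μ (fun ω => U (W ω)) ≤ ((∫ ω, C * (1 + W ω) ∂μ : ℝ) : EReal) := by
  rw [expectation_eq_sub_shortfall hU hC0 hC hW hW0]
  exact EReal.sub_le_of_le_add (le_add_of_nonneg_right (EReal.coe_ennreal_nonneg _))

/-- Superlevel sets of the expected utility are convex. -/
theorem le_expectation_convex (hU : IsUtility U) {C : ℝ} (hC0 : 0 ≤ C)
    (hC : ∀ x, U x ≤ ((C * (1 + x) : ℝ) : EReal)) [IsFiniteMeasure μ] {W' : Ω → ℝ}
    (hW : Integrable W μ) (hW0 : ∀ᵐ ω ∂μ, 0 ≤ W ω) (hW' : Integrable W' μ)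
    (hW0' : ∀ᵐ ω ∂μ, 0 ≤ W' ω) {a b : ℝ} (ha : 0 < a) (hb : 0 < b) (hab : a + b = 1) {r : ℝ}
    (h : (r : EReal) ≤ expectation μ (fun ω => U (W ω)))
    (h' : (r : EReal) ≤ expectation μ (fun ω => U (W' ω))) :
    (r : EReal) ≤ expectation μ (fun ω => U (a * W ω + b * W' ω)) := by
  rw [le_expectation_iff hU hC0 hC hW hW0] at h
  rw [le_expectation_iff hU hC0 hC hW' hW0'] at h'
  rw [le_expectation_iff (W := fun ω => a * W ω + b * W' ω) hU hC0 hC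
    ((hW.const_mul a).add (hW'.const_mul b))
    (by filter_upwards [hW0, hW0'] with ω h1 h2; positivity)]
  have hI : ∫ ω, C * (1 + (a * W ω + b * W' ω)) ∂μ =
      a * ∫ ω, C * (1 + W ω) ∂μ + b * ∫ ω, C * (1 + W' ω) ∂μ := by
    have i1 : Integrable (fun ω => C * (1 + W ω)) μ := ((integrable_const 1).add hW).const_mul C
    have i2 : Integrable (fun ω => C * (1 + W' ω)) μ := ((integrable_const 1).add hW').const_mul C
    rw [← integral_const_mul, ← integral_const_mul,
      ← integral_add (i1.const_mul a) (i2.const_mul b)]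
    refine integral_congr_ae (ae_of_all _ fun ω => ?_)
    simp only
    linear_combination (-C) * hab
  rw [hI]
  have hr : r = a * r + b * r := by rw [← add_mul, hab, one_mul]
  have h1 := mul_le_mul_of_nonneg_left h.1 ha.le
  have h2 := mul_le_mul_of_nonneg_left h'.1 hb.le
  refine ⟨by linarith, ?_⟩
  have hm : AEMeasurable (fun ω => shortfall C U (W ω)) μ :=
    (measurable_shortfall hU C).comp_aemeasurable hW.aemeasurable
  have hm' : AEMeasurable (fun ω => shortfall C U (W' ω)) μ :=
    (measurable_shortfall hU C).comp_aemeasurable hW'.aemeasurable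
  calc ∫⁻ ω, shortfall C U (a * W ω + b * W' ω) ∂μ
      ≤ ∫⁻ ω, ENNReal.ofReal a * shortfall C U (W ω) + ENNReal.ofReal b * shortfall C U (W' ω) ∂μ :=
        lintegral_mono fun ω => shortfall_convex hU hC ha hb hab _ _
    _ = ENNReal.ofReal a * ∫⁻ ω, shortfall C U (W ω) ∂μ +
          ENNReal.ofReal b * ∫⁻ ω, shortfall C U (W' ω) ∂μ := by
        rw [lintegral_add_left' (hm.const_mul _), lintegral_const_mul'' _ hm,
          lintegral_const_mul'' _ hm']
    _ ≤ ENNReal.ofReal a * ENNReal.ofReal (∫ ω, C * (1 + W ω) ∂μ - r) +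
          ENNReal.ofReal b * ENNReal.ofReal (∫ ω, C * (1 + W' ω) ∂μ - r) := by
        gcongr
        · exact h.2
        · exact h'.2
    _ = _ := by
        rw [← ENNReal.ofReal_mul ha.le, ← ENNReal.ofReal_mul hb.le, ← ENNReal.ofReal_add]
        · congr 1; linarith
        · exact mul_nonneg ha.le (by linarith)
        · exact mul_nonneg hb.le (by linarith)

/-- Superlevel sets of the expected utility are closed under dominated almost sure convergence. -/
theorem le_expectation_of_tendsto (hU : IsUtility U) {C : ℝ} (hC0 : 0 ≤ C)
    (hC : ∀ x, U x ≤ ((C * (1 + x) : ℝ) : EReal)) [IsFiniteMeasure μ] {Wn : ℕ → Ω → ℝ}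
    (hWn : ∀ n, Integrable (Wn n) μ) (hWn0 : ∀ n, ∀ᵐ ω ∂μ, 0 ≤ Wn n ω) {B : Ω → ℝ}
    (hB : Integrable B μ) (hle : ∀ n, ∀ᵐ ω ∂μ, ‖Wn n ω‖ ≤ B ω) (hW : Integrable W μ)
    (hlim : ∀ᵐ ω ∂μ, Tendsto (fun n => Wn n ω) atTop (𝓝 (W ω))) {r : ℝ}
    (h : ∀ n, (r : EReal) ≤ expectation μ (fun ω => U (Wn n ω))) :
    (r : EReal) ≤ expectation μ (fun ω => U (W ω)) := by
  have hW0 : ∀ᵐ ω ∂μ, 0 ≤ W ω := by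
    filter_upwards [hlim, ae_all_iff.2 hWn0] with ω h1 h2
    exact ge_of_tendsto' h1 h2
  rw [le_expectation_iff hU hC0 hC hW hW0]
  simp_rw [fun n => le_expectation_iff hU hC0 hC (hWn n) (hWn0 n) r] at h
  have hI : ∀ {V : Ω → ℝ}, Integrable V μ →
      ∫ ω, C * (1 + V ω) ∂μ = C * (μ.real Set.univ + ∫ ω, V ω ∂μ) := by
    intro V hV
    rw [integral_const_mul, integral_add (integrable_const _) hV]
    simp
  have ht : Tendsto (fun n => ∫ ω, C * (1 + Wn n ω) ∂μ) atTop (𝓝 (∫ ω, C * (1 + W ω) ∂μ)) := by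
    simp_rw [fun n => hI (hWn n), hI hW]
    exact ((tendsto_integral_of_dominated_convergence B
      (fun n => (hWn n).aestronglyMeasurable) hB hle hlim).const_add _).const_mul _
  refine ⟨ge_of_tendsto' ht fun n => (h n).1, ?_⟩
  -- Lower semicontinuity, then Fatou's lemma; the bounds on the right converge by `ht`.
  calc ∫⁻ ω, shortfall C U (W ω) ∂μ
      ≤ ∫⁻ ω, liminf (fun n => shortfall C U (Wn n ω)) atTop ∂μ := by
        refine lintegral_mono_ae ?_
        filter_upwards [hlim] with ω hω
        refine le_of_forall_lt fun c hc => ?_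
        obtain ⟨c', hc1, hc2⟩ := exists_between hc
        refine hc1.trans_le (le_liminf_of_le (by isBoundedDefault) ?_)
        filter_upwards [hω.eventually (lowerSemicontinuous_shortfall hU C _ c' hc2)] with n hn
        exact hn.le
    _ ≤ liminf (fun n => ∫⁻ ω, shortfall C U (Wn n ω) ∂μ) atTop :=
        lintegral_liminf_le' fun n =>
          (measurable_shortfall hU C).comp_aemeasurable (hWn n).aemeasurable
    _ ≤ liminf (fun n => ENNReal.ofReal (∫ ω, C * (1 + Wn n ω) ∂μ - r)) atTop :=
        liminf_le_liminf (Eventually.of_forall fun n => (h n).2)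
    _ = _ := (ENNReal.tendsto_ofReal (ht.sub_const r)).liminf_eq

end Utility

/-! ### Conditional laws and the affine hulls of their supports. -/

section OnePeriod

variable {Ω : Type*} {d : ℕ}

theorem inner_eq_zero_of_mem_span_support {ν : Measure (EuclideanSpace ℝ (Fin d))} {v : EuclideanSpace ℝ (Fin d)}
    (h : ∀ᵐ x ∂ν, inner ℝ x v = 0) {x : EuclideanSpace ℝ (Fin d)} (hx : x ∈ Submodule.span ℝ ν.support) :
    inner ℝ x v = 0 := by
  have hcl : IsClosed {x : EuclideanSpace ℝ (Fin d) | inner ℝ x v = 0} :=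
    isClosed_eq (by fun_prop) continuous_const
  have hsub : ν.support ⊆ {x : EuclideanSpace ℝ (Fin d) | inner ℝ x v = 0} := Measure.support_subset_of_isClosed hcl h
  induction hx using Submodule.span_induction with
  | mem x hx => exact hsub hx
  | zero => simp
  | add x y _ _ hx hy => rw [inner_add_left, hx, hy, add_zero]
  | smul a x _ hx => rw [inner_smul_left, hx, mul_zero]

theorem coe_affineSpan_eq_span {s : Set (EuclideanSpace ℝ (Fin d))} (h : (0 : EuclideanSpace ℝ (Fin d)) ∈ affineSpan ℝ s) :
    (affineSpan ℝ s : Set (EuclideanSpace ℝ (Fin d))) = Submodule.span ℝ s := by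
  rw [← affineSpan_insert_zero, affineSpan_insert_eq_affineSpan ℝ h]

/-- In finite dimension the span is its own double orthogonal complement, and a vector orthogonal to
the support is orthogonal to almost every point. -/
theorem mem_span_support {ν : Measure (EuclideanSpace ℝ (Fin d))} {y : EuclideanSpace ℝ (Fin d)}
    (h : ∀ u : EuclideanSpace ℝ (Fin d), (∀ᵐ x ∂ν, inner ℝ x u = 0) → inner ℝ u y = 0) :
    y ∈ Submodule.span ℝ ν.support := by
  rw [← Submodule.orthogonal_orthogonal (Submodule.span ℝ ν.support), Submodule.mem_orthogonal]
  intro u hu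
  refine h u ?_
  filter_upwards [Measure.support_mem_ae (μ := ν)] with x hx
  exact (Submodule.mem_orthogonal _ _).1 hu x (Submodule.subset_span hx)

/-- The foot `p - r` of the perpendicular from `0` to the affine hull satisfies `⟪x, p - r⟫ = ‖p -
r‖²` throughout the hull. This is an affine relation of the kind in `h`, so `p - r = 0`. -/
theorem zero_mem_affineSpan_support {ν : Measure (EuclideanSpace ℝ (Fin d))} (hν : ν ≠ 0)
    (h : ∀ (a : ℝ) (u : EuclideanSpace ℝ (Fin d)), (∀ᵐ x ∂ν, a + inner ℝ x u = 0) → a = 0) :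
    (0 : EuclideanSpace ℝ (Fin d)) ∈ affineSpan ℝ ν.support := by
  obtain ⟨p, hp⟩ := Measure.nonempty_support hν
  set A := affineSpan ℝ ν.support
  have hpA : p ∈ A := subset_affineSpan ℝ _ hp
  set r := A.direction.starProjection p
  have hr : r ∈ A.direction := A.direction.starProjection_apply_mem p
  have horth : ∀ z ∈ A.direction, inner ℝ z (p - r) = 0 := fun z hz => by
    rw [real_inner_comm]
    exact A.direction.starProjection_inner_eq_zero p z hz
  have hx : ∀ x ∈ A, inner ℝ x (p - r) = ‖p - r‖ ^ 2 := fun x hx => by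
    have h1 := horth _ (A.vsub_mem_direction hx hpA)
    rw [vsub_eq_sub, inner_sub_left] at h1
    rw [sub_eq_zero.1 h1, ← real_inner_self_eq_norm_sq, inner_sub_left (p) r, horth r hr, sub_zero]
  have h0 := h (-‖p - r‖ ^ 2) (p - r) (by
    filter_upwards [Measure.support_mem_ae (μ := ν)] with x hxs
    rw [hx x (subset_affineSpan ℝ _ hxs)]
    ring)
  have h1 : p - r = 0 := by simpa using h0
  have h2 := A.vadd_mem_of_mem_direction (A.direction.neg_mem hr) hpA
  rw [vadd_eq_add, neg_add_eq_sub, h1] at h2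
  exact h2

variable {m mΩ : MeasurableSpace Ω} {μ : Measure Ω} [IsFiniteMeasure μ] {X : Ω → EuclideanSpace ℝ (Fin d)}

/-- The conditional law as a kernel. -/
def condLawKernel (μ : Measure Ω) [IsFiniteMeasure μ] (m : MeasurableSpace Ω) (X : Ω → EuclideanSpace ℝ (Fin d)) :
    @Kernel Ω (EuclideanSpace ℝ (Fin d)) m _ :=
  @condDistrib Ω Ω (EuclideanSpace ℝ (Fin d)) _ _ _ mΩ m X id μ _

instance : @IsMarkovKernel Ω (EuclideanSpace ℝ (Fin d)) m _ (condLawKernel μ m X) := by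
  unfold condLawKernel
  infer_instance

theorem condLawKernel_apply (ω : Ω) : condLawKernel μ m X ω = condLaw μ m X ω := rfl

instance (ω : Ω) : IsProbabilityMeasure (condLaw μ m X ω) :=
  (inferInstance : @IsMarkovKernel Ω (EuclideanSpace ℝ (Fin d)) m _ (condLawKernel μ m X)).isProbabilityMeasure ω

/-- The joint law of `(f, X)` disintegrates into the law of `f` and the conditional law. The case of
interest is `f = id`, from `mΩ` to the smaller σ-algebra. -/
theorem ae_of_ae_condDistrib {Ω' : Type*} {m' : MeasurableSpace Ω'} {f : Ω → Ω'}
    (hf : Measurable f) (hX : Measurable X) {p : Ω' × EuclideanSpace ℝ (Fin d) → Prop} (hp : MeasurableSet {x | p x})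
    (h : ∀ᵐ ω ∂μ, ∀ᵐ x ∂condDistrib X f μ (f ω), p (f ω, x)) : ∀ᵐ ω ∂μ, p (f ω, X ω) := by
  have hset : MeasurableSet {ω | ∀ᵐ x ∂condDistrib X f μ ω, p (ω, x)} :=
    Kernel.measurable_kernel_prodMk_left hp.compl (measurableSet_singleton 0)
  have h1 := (Measure.ae_compProd_iff hp).2 ((ae_map_iff hf.aemeasurable hset).2 h)
  rw [compProd_map_condDistrib hX.aemeasurable] at h1
  exact ae_of_ae_map (hf.prodMk hX).aemeasurable h1

theorem ae_of_ae_condLaw (hm : m ≤ mΩ) (hX : Measurable X) {p : Ω × EuclideanSpace ℝ (Fin d) → Prop}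
    (hp : MeasurableSet[@Prod.instMeasurableSpace Ω (EuclideanSpace ℝ (Fin d)) m _] {x | p x})
    (h : ∀ᵐ ω ∂μ, ∀ᵐ x ∂condLaw μ m X ω, p (ω, x)) : ∀ᵐ ω ∂μ, p (ω, X ω) :=
  ae_of_ae_condDistrib (m' := m) (f := id) (measurable_id'' hm) hX hp h

/-- Either `0` lies in the affine hull of the support of the conditional law, or the increment is
bounded away from `0` in a direction that can be chosen measurably. -/
theorem exists_measurable_separation (hm : m ≤ mΩ) (hX : Measurable X) :
    ∃ (c : Ω → ℝ) (v : Ω → EuclideanSpace ℝ (Fin d)), Measurable[m] c ∧ Measurable[m] v ∧ (∀ ω, 0 ≤ c ω) ∧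
      (∀ᵐ ω ∂μ, c ω + inner ℝ (X ω) (v ω) = 0) ∧
      ∀ ω, c ω = 0 → (0 : EuclideanSpace ℝ (Fin d)) ∈ affineSpan ℝ (condLaw μ m X ω).support := by
  -- Project `(1, 0)` onto the space of pairs `(a, u)` with `a + ⟪x, u⟫ = 0` for almost all `x`. The
  -- first coordinate of the projection is its squared norm, so it is non-negative; if it vanishes,
  -- `(1, 0)` is orthogonal to all such pairs, which therefore have `a = 0`.
  obtain ⟨π, hπ, h⟩ := exists_measurable_projection (V := WithLp 2 (ℝ × EuclideanSpace ℝ (Fin d)))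
    (condLawKernel μ m X) (g := fun x => WithLp.toLp 2 (1, x))
    (Continuous.measurable (by fun_prop)) (φ := fun _ => WithLp.toLp 2 (1, 0))
    (@measurable_const _ _ _ m _)
  have hc : ∀ ω, (π ω).fst = ‖π ω‖ ^ 2 := fun ω => by
    have := (h ω).2 (π ω) (h ω).1
    rw [inner_sub_right, real_inner_self_eq_norm_sq, WithLp.prod_inner_apply] at this
    simp at this
    linarith
  have hf : Measurable (WithLp.fst : WithLp 2 (ℝ × EuclideanSpace ℝ (Fin d)) → ℝ) := Continuous.measurable (by fun_prop)
  have hs : Measurable (WithLp.snd : WithLp 2 (ℝ × EuclideanSpace ℝ (Fin d)) → EuclideanSpace ℝ (Fin d)) := Continuous.measurable (by fun_prop)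
  have hfm : Measurable[m] fun ω => (π ω).fst := hf.comp hπ
  have hsm : Measurable[m] fun ω => (π ω).snd := hs.comp hπ
  refine ⟨fun ω => (π ω).fst, fun ω => (π ω).snd, hfm, hsm,
    fun ω => by simp only [hc]; positivity, ?_, fun ω h0 => ?_⟩
  · refine ae_of_ae_condLaw hm hX (p := fun z => (π z.1).fst + inner ℝ z.2 (π z.1).snd = 0) ?_
      (ae_of_all _ fun ω => ?_)
    · let := m
      exact measurableSet_eq_fun ((hfm.comp measurable_fst).add
        (measurable_snd.inner (hsm.comp measurable_fst))) measurable_const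
    · filter_upwards [(h ω).1] with x hx
      simpa [WithLp.prod_inner_apply] using hx
  · simp only [hc] at h0
    have hπ0 : π ω = 0 := by simpa using h0
    refine zero_mem_affineSpan_support (IsProbabilityMeasure.ne_zero _) fun a u hau => ?_
    have := (h ω).2 (WithLp.toLp 2 (a, u)) (by
      filter_upwards [hau] with x hx
      simpa [WithLp.prod_inner_apply] using hx)
    simpa [hπ0, WithLp.prod_inner_apply] using this

/-- A measurable portfolio can be projected measurably onto the span of the support of the
conditional law; the discarded part is worthless in all models with smaller span. -/
theorem exists_measurable_projection_condSpan (hm : m ≤ mΩ)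
    (h0 : ∀ᵐ ω ∂μ, (0 : EuclideanSpace ℝ (Fin d)) ∈ affineSpan ℝ (condLaw μ m X ω).support) {φ : Ω → EuclideanSpace ℝ (Fin d)}
    (hφ : Measurable[m] φ) :
    ∃ ξ : Ω → EuclideanSpace ℝ (Fin d), Measurable[m] ξ ∧
      (∀ᵐ ω ∂μ, ξ ω ∈ affineSpan ℝ (condLaw μ m X ω).support) ∧
      ∀ Y : Ω → EuclideanSpace ℝ (Fin d), Measurable Y → (∀ᵐ ω ∂μ, affineSpan ℝ (condLaw μ m Y ω).support ≤
        affineSpan ℝ (condLaw μ m X ω).support) →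
        ∀ᵐ ω ∂μ, inner ℝ (ξ ω) (Y ω) = inner ℝ (φ ω) (Y ω) := by
  -- Here `π` is the component of `φ` orthogonal to the support, so `φ - π` is the projection onto
  -- its span.
  obtain ⟨π, hπ, h⟩ := exists_measurable_projection (condLawKernel μ m X) (g := fun x => x)
    measurable_id hφ
  refine ⟨fun ω => φ ω - π ω, hφ.sub hπ, ?_, fun Y hY hle => ?_⟩
  · filter_upwards [h0] with ω hω
    rw [← SetLike.mem_coe, coe_affineSpan_eq_span hω]
    exact mem_span_support (h ω).2
  · have key : ∀ᵐ ω ∂μ, inner ℝ (Y ω) (π ω) = 0 := by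
      refine ae_of_ae_condLaw hm hY (p := fun z => inner ℝ z.2 (π z.1) = 0) ?_ ?_
      · let := m
        exact measurableSet_eq_fun (measurable_snd.inner (hπ.comp measurable_fst)) measurable_const
      · filter_upwards [h0, hle] with ω h0ω hω
        filter_upwards [Measure.support_mem_ae (μ := condLaw μ m Y ω)] with x hx
        refine inner_eq_zero_of_mem_span_support (h ω).1 ?_
        rw [← SetLike.mem_coe, condLawKernel_apply, ← coe_affineSpan_eq_span h0ω]
        exact hω (subset_affineSpan ℝ _ hx)
    filter_upwards [key] with ω hω
    rw [inner_sub_left, real_inner_comm (Y ω) (π ω), hω, sub_zero]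

end OnePeriod

/-! ### Reduction to the conditional spans, and bounds on feasible portfolios. -/

section Strategies

variable {Ω : Type*} {mΩ : MeasurableSpace Ω} {d T : ℕ} {μ : Measure Ω} {ℱ : Filtration ℕ mΩ}
  {S φ : RandomPath Ω d} {w : ℝ}

theorem wealth_succ (w : ℝ) (S φ : RandomPath Ω d) (t : ℕ) (ω : Ω) :
    wealth w S φ (t + 1) ω = wealth w S φ t ω + inner ℝ (φ t ω) (priceChange S t ω) := by
  rw [wealth, wealth, Finset.sum_range_succ, add_assoc]

theorem measurable_priceChange (hS : ∀ t ≤ T, Measurable[ℱ t] (S t)) {t : ℕ} (ht : t < T) :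
    Measurable[ℱ (t + 1)] (priceChange S t) :=
  (hS (t + 1) ht).sub ((hS t ht.le).mono (ℱ.mono t.le_succ) le_rfl)

theorem measurable_priceChange' (hS : ∀ t ≤ T, Measurable[ℱ t] (S t)) {t : ℕ} (ht : t < T) :
    Measurable (priceChange S t) :=
  (measurable_priceChange hS ht).mono (ℱ.le _) le_rfl

theorem measurable_wealth (hS : ∀ t ≤ T, Measurable[ℱ t] (S t)) (hφ : φ ∈ strategies ℱ T) {t : ℕ}
    (ht : t ≤ T) : Measurable[ℱ t] (wealth w S φ t) := by
  have : ∀ s ∈ Finset.range t,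
      Measurable[ℱ t] fun ω => (inner ℝ (φ s ω) (priceChange S s ω) : ℝ) := by
    intro s hs
    have hst := Finset.mem_range.1 hs
    exact ((hφ s (hst.trans_le ht)).mono (ℱ.mono hst.le) le_rfl).inner
      ((measurable_priceChange hS (hst.trans_le ht)).mono (ℱ.mono hst) le_rfl)
  exact (Finset.measurable_fun_sum _ this).const_add w

theorem measurable_wealth' (hS : ∀ t ≤ T, Measurable[ℱ t] (S t)) (hφ : φ ∈ strategies ℱ T) {t : ℕ}
    (ht : t ≤ T) : Measurable (wealth w S φ t) :=
  (measurable_wealth hS hφ ht).mono (ℱ.le _) le_rfl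

variable [IsFiniteMeasure μ]

/-- In the absence of arbitrage the conditional affine hulls are linear subspaces. -/
theorem NoArbitrage.zero_mem_condSpan (hNA : NoArbitrage μ ℱ T w S) (hw : 0 ≤ w)
    (hS : ∀ t ≤ T, Measurable[ℱ t] (S t)) {t : ℕ} (ht : t < T) :
    ∀ᵐ ω ∂μ, (0 : EuclideanSpace ℝ (Fin d)) ∈ condSpan μ ℱ S t ω := by
  obtain ⟨c, v, -, hv, hc0, hcv, hc⟩ :=
    exists_measurable_separation (μ := μ) (ℱ.le t) (measurable_priceChange' hS ht)
  -- Holding `-v` in this period only earns `c ≥ 0`, so absence of arbitrage forces `c = 0`.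
  set φ : RandomPath Ω d := fun s ω => if s = t then -v ω else 0 with hφ
  have hwealth : ∀ (x : ℝ) (s : ℕ) (ω : Ω), c ω + inner ℝ (priceChange S t ω) (v ω) = 0 →
      wealth x S φ s ω = x + if t < s then c ω else 0 := by
    intro x s ω h
    have : ∀ r, (inner ℝ (φ r ω) (priceChange S r ω) : ℝ) = if t = r then c ω else 0 := by
      intro r
      by_cases hr : r = t
      · subst hr
        simp only [hφ, if_true, inner_neg_left]
        rw [real_inner_comm]
        linarith
      · simp [hφ, hr, Ne.symm hr]
    simp only [wealth, this, Finset.sum_ite_eq, Finset.mem_range]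
  have hfeas : φ ∈ feasible μ ℱ T w S := by
    refine ⟨fun s _ => ?_, fun s _ => ?_⟩
    · by_cases hs : s = t
      · subst hs
        simp only [hφ, if_true]
        exact hv.neg
      · simp only [hφ, hs, if_false]
        exact measurable_const
    · filter_upwards [hcv] with ω hω
      rw [hwealth w s ω hω]
      have := hc0 ω
      split_ifs <;> linarith
  have h0 := hNA φ hfeas (by
    filter_upwards [hcv] with ω hω
    rw [hwealth 0 T ω hω, if_pos ht, zero_add]
    exact hc0 ω)
  filter_upwards [hcv, h0] with ω h1 h2
  rw [hwealth 0 T ω h1, if_pos ht, zero_add] at h2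
  exact hc ω h2

/-- Every strategy has the same wealth, in all models, as one that takes values in the conditional
spans of an arbitrage-free model. -/
theorem exists_strategy_mem_condSpan {𝒮 : Set (RandomPath Ω d)}
    (hadapted : ∀ S ∈ 𝒮, ∀ t ≤ T, Measurable[ℱ t] (S t)) {S' : RandomPath Ω d}
    (hS' : S' ∈ arbitrageFreeModels μ ℱ T w 𝒮) (hw : 0 ≤ w) (hφ : φ ∈ strategies ℱ T) :
    ∃ ξ ∈ strategies ℱ T, (∀ t < T, ∀ᵐ ω ∂μ, ξ t ω ∈ condSpan μ ℱ S' t ω) ∧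
      ∀ S ∈ 𝒮, ∀ t ≤ T, ∀ᵐ ω ∂μ, wealth w S ξ t ω = wealth w S φ t ω := by
  obtain ⟨hmem, hNA, hle⟩ := hS'
  have key : ∀ t, ∃ ξ : Ω → EuclideanSpace ℝ (Fin d), t < T →
      Measurable[ℱ t] ξ ∧ (∀ᵐ ω ∂μ, ξ ω ∈ condSpan μ ℱ S' t ω) ∧
      ∀ S ∈ 𝒮, ∀ᵐ ω ∂μ,
        inner ℝ (ξ ω) (priceChange S t ω) = inner ℝ (φ t ω) (priceChange S t ω) := by
    intro t
    by_cases ht : t < T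
    · obtain ⟨ξ, h1, h2, h3⟩ := exists_measurable_projection_condSpan (ℱ.le t)
        (hNA.zero_mem_condSpan hw (hadapted S' hmem) ht) (hφ t ht)
      exact ⟨ξ, fun _ => ⟨h1, h2, fun S hS =>
        h3 _ (measurable_priceChange' (hadapted S hS) ht) (hle S hS t ht)⟩⟩
    · exact ⟨0, fun h => absurd h ht⟩
  choose ξ hξ using key
  refine ⟨ξ, fun t ht => (hξ t ht).1, fun t ht => (hξ t ht).2.1, fun S hS t ht => ?_⟩
  have : ∀ᵐ ω ∂μ, ∀ s ∈ Finset.range t,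
      inner ℝ (ξ s ω) (priceChange S s ω) = inner ℝ (φ s ω) (priceChange S s ω) :=
    (Finset.eventually_all _).2 fun s hs => (hξ s ((Finset.mem_range.1 hs).trans_le ht)).2.2 S hS
  filter_upwards [this] with ω hω
  rw [wealth, wealth, Finset.sum_congr rfl hω]

/-- The quantitative absence of arbitrage bounds feasible portfolios by the current wealth. -/
theorem IsArbitrageBound.mul_norm_le_wealth {t : ℕ} {β κ : Ω → ℝ}
    (hβ : IsArbitrageBound μ ℱ S t β κ) (hS : ∀ t ≤ T, Measurable[ℱ t] (S t)) (ht : t < T)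
    (hφ : φ ∈ feasible μ ℱ T w S) (hspan : ∀ᵐ ω ∂μ, φ t ω ∈ condSpan μ ℱ S t ω) :
    ∀ᵐ ω ∂μ, β ω * ‖φ t ω‖ ≤ wealth w S φ t ω := by
  obtain ⟨hβm, -, hβ0, hκ0, h⟩ := hβ
  have hφt := hφ.1 t ht
  set ev : Set Ω := {ω' | inner ℝ (φ t ω') (priceChange S t ω') ≤ -β ω' * ‖φ t ω'‖} with hev
  -- On `A ∩ ev` the next wealth is negative, so this set is null. As `A` is `ℱ t`-measurable, the
  -- conditional probability of `ev` vanishes on `A`, contradicting the bound `κ > 0` unless the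
  -- span is `{0}`.
  set A : Set Ω := {ω | wealth w S φ t ω < β ω * ‖φ t ω‖} with hA
  have hAm : MeasurableSet[ℱ t] A := by
    have hdiff : Measurable[ℱ t] fun ω => wealth w S φ t ω - β ω * ‖φ t ω‖ :=
      (measurable_wealth hS hφ.1 ht.le).sub (hβm.mul (measurable_norm.comp hφt))
    convert hdiff (measurableSet_Iio (a := 0)) using 1
    ext ω
    simp [hA]
  have hevm : MeasurableSet ev :=
    measurableSet_le ((hφt.mono (ℱ.le t) le_rfl).inner (measurable_priceChange' hS ht))
      ((hβm.mono (ℱ.le t) le_rfl).neg.mul (hφt.mono (ℱ.le t) le_rfl).norm)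
  have hnull : μ (A ∩ ev) = 0 := by
    rw [← compl_compl (A ∩ ev)]
    change ∀ᵐ ω ∂μ, ω ∈ (A ∩ ev)ᶜ
    filter_upwards [hφ.2 (t + 1) ht] with ω hω
    rw [wealth_succ] at hω
    rintro ⟨h1, h2⟩
    simp only [hA, hev, Set.mem_ofPred_eq] at h1 h2
    linarith
  have hint : Integrable (ev.indicator fun _ => (1 : ℝ)) μ :=
    (integrable_const 1).indicator hevm
  have hcond : ∀ᵐ ω ∂μ, ω ∈ A → (μ⟦ev | ℱ t⟧) ω = 0 := by
    rw [← ae_restrict_iff' (ℱ.le t _ hAm)]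
    have hzero : ∫ ω in A, (μ⟦ev | ℱ t⟧) ω ∂μ = 0 := by
      rw [setIntegral_condExp (ℱ.le t) hint hAm, setIntegral_indicator hevm,
        setIntegral_measure_zero _ hnull]
    have hnn : 0 ≤ᵐ[μ] μ⟦ev | ℱ t⟧ :=
      condExp_nonneg (ae_of_all _ fun ω => Set.indicator_nonneg (fun _ _ => zero_le_one) ω)
    exact (setIntegral_eq_zero_iff_of_nonneg_ae (ae_restrict_of_ae hnn)
      integrable_condExp.integrableOn).1 hzero
  filter_upwards [hcond, h (φ t) hφt hspan, hκ0, hspan, hφ.2 t ht.le] with ω h1 h2 h3 h4 h5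
  by_contra hcon
  rw [not_le] at hcon
  by_cases hD : (condSpan μ ℱ S t ω : Set (EuclideanSpace ℝ (Fin d))) = {0}
  · rw [← SetLike.mem_coe, hD, Set.mem_singleton_iff] at h4
    rw [h4, norm_zero, mul_zero] at hcon
    linarith
  · have h6 := h2 hD
    rw [h1 hcon] at h6
    linarith

/-- The largest wealth that can be reached up to time `t` by a portfolio that respects the bounds
`‖φ s‖ ≤ b s * wealth s`. -/
def wealthBound (w : ℝ) (S : RandomPath Ω d) (b : ℕ → Ω → ℝ) (t : ℕ) (ω : Ω) : ℝ :=
  w * ∏ s ∈ Finset.range t, (1 + b s ω * ‖priceChange S s ω‖)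

/-- By Cauchy–Schwarz each period multiplies the wealth by at most `1 + b ‖ΔS‖`. -/
theorem wealth_le_wealthBound {b : ℕ → Ω → ℝ} {ω : Ω} {t : ℕ} (hb : ∀ s < t, 0 ≤ b s ω)
    (h : ∀ s < t, ‖φ s ω‖ ≤ b s ω * wealth w S φ s ω) :
    wealth w S φ t ω ≤ wealthBound w S b t ω := by
  induction t with
  | zero => simp [wealth, wealthBound]
  | succ t ih =>
    have ih' := ih (fun s hs => hb s (hs.trans t.lt_succ_self))
      (fun s hs => h s (hs.trans t.lt_succ_self))
    have hbt := hb t t.lt_succ_self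
    have hp : 0 ≤ ‖priceChange S t ω‖ := norm_nonneg _
    rw [wealth_succ]
    calc wealth w S φ t ω + inner ℝ (φ t ω) (priceChange S t ω)
        ≤ wealth w S φ t ω + b t ω * wealth w S φ t ω * ‖priceChange S t ω‖ := by
          gcongr
          exact (real_inner_le_norm _ _).trans (by gcongr; exact h t t.lt_succ_self)
      _ = wealth w S φ t ω * (1 + b t ω * ‖priceChange S t ω‖) := by ring
      _ ≤ wealthBound w S b t ω * (1 + b t ω * ‖priceChange S t ω‖) := by gcongr
      _ = _ := by rw [wealthBound, wealthBound, Finset.prod_range_succ, mul_assoc]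

end Strategies

/-! ### Integrability of the bounds. -/

section Moments

variable {Ω : Type*} {mΩ : MeasurableSpace Ω} {μ : Measure Ω}

theorem memLp_of_mem_finiteMoments {m : MeasurableSpace Ω} (hm : m ≤ mΩ) {X : Ω → ℝ}
    (hX : X ∈ finiteMoments μ m) {p : ℝ≥0∞} (hp : p ≠ ∞) : MemLp X p μ := by
  have hXm : AEStronglyMeasurable[mΩ] X μ := (hX.1.mono hm le_rfl).aestronglyMeasurable
  by_cases h0 : p = 0
  · rw [h0]
    exact memLp_zero_iff_aestronglyMeasurable.2 hXm
  · exact (integrable_norm_rpow_iff hXm h0 hp).1 (hX.2 _ (ENNReal.toReal_pos h0 hp))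

/-- Hölder's inequality with exponents `2p, 2p`. Each product doubles the exponent required, hence
the quantification over all finite ones. -/
theorem memLp_mul_of_forall {X Y : Ω → ℝ} (hX : ∀ p : ℝ≥0∞, p ≠ ∞ → MemLp X p μ)
    (hY : ∀ p : ℝ≥0∞, p ≠ ∞ → MemLp Y p μ) {p : ℝ≥0∞} (hp : p ≠ ∞) :
    MemLp (fun ω => X ω * Y ω) p μ := by
  have h2 : (2 : ℝ≥0∞) * p ≠ ∞ := ENNReal.mul_ne_top (by simp) hp
  have : ENNReal.HolderTriple (2 * p) (2 * p) p := ⟨by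
    rw [ENNReal.mul_inv (Or.inl two_ne_zero) (Or.inl ENNReal.ofNat_ne_top), ← add_mul,
      ENNReal.inv_two_add_inv_two, one_mul]⟩
  exact (hY _ h2).mul' (hX _ h2)

theorem memLp_wealthBound [IsFiniteMeasure μ] {d : ℕ} {w : ℝ} {S : RandomPath Ω d}
    {b : ℕ → Ω → ℝ} {t : ℕ} (hb : ∀ s < t, ∀ p : ℝ≥0∞, p ≠ ∞ → MemLp (b s) p μ)
    (hS : ∀ s < t, ∀ p : ℝ≥0∞, p ≠ ∞ → MemLp (fun ω => ‖priceChange S s ω‖) p μ)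
    {p : ℝ≥0∞} (hp : p ≠ ∞) : MemLp (wealthBound w S b t) p μ := by
  refine MemLp.const_mul ?_ w
  induction t generalizing p with
  | zero => simpa using memLp_const (μ := μ) (p := p) (1 : ℝ)
  | succ t ih =>
    simp_rw [Finset.prod_range_succ]
    refine memLp_mul_of_forall (fun q hq => ih (fun s hs => hb s (hs.trans t.lt_succ_self))
      (fun s hs => hS s (hs.trans t.lt_succ_self)) hq) (fun q hq => ?_) hp
    have h1 := memLp_mul_of_forall (hb t t.lt_succ_self) (hS t t.lt_succ_self) hq
    exact MemLp.add (f := fun _ => (1 : ℝ)) (memLp_const 1) h1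

end Moments

/-! ### Compactness of the set of dominated strategies. -/

section Candidates

variable {Ω : Type*} {mΩ : MeasurableSpace Ω} {d T : ℕ} {μ : Measure Ω} {ℱ : Filtration ℕ mΩ}
  {𝒮 : Set (RandomPath Ω d)} {S φ ψ : RandomPath Ω d} {w : ℝ} {U : ℝ → EReal} {G : ℕ → Ω → ℝ} {r : ℝ}

/-- Containing all null sets makes the trimmed measure complete, so almost sure limits stay
`m`-measurable. -/
theorem measurable_of_ae_tendsto {m : MeasurableSpace Ω} (hm : m ≤ mΩ)
    (hnull : ∀ N : Set Ω, μ N = 0 → MeasurableSet[m] N) {F : Type*} [TopologicalSpace F]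
    [TopologicalSpace.PseudoMetrizableSpace F] [MeasurableSpace F] [BorelSpace F] {f : ℕ → Ω → F}
    {g : Ω → F} (hf : ∀ n, Measurable[m] (f n))
    (hlim : ∀ᵐ ω ∂μ, Tendsto (fun n => f n ω) atTop (𝓝 (g ω))) : Measurable[m] g := by
  have hcomplete : @Measure.IsComplete Ω m (μ.trim hm) :=
    @Measure.IsComplete.mk _ m _ fun s hs => hnull s (measure_eq_zero_of_trim_eq_zero hm hs)
  refine @measurable_of_tendsto_metrizable_ae Ω F m _ _ _ _ (μ.trim hm) hcomplete f g hf ?_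
  have hlim' := ae_iff.1 hlim
  exact (trim_measurableSet_eq hm (hnull _ hlim')).trans hlim'

/-- Admissible strategies that are dominated by `G` and have worst-case utility at least `r`. -/
def candidates (μ : Measure Ω) (ℱ : Filtration ℕ mΩ) (T : ℕ) (w : ℝ) (𝒮 : Set (RandomPath Ω d))
    (U : ℝ → EReal) (G : ℕ → Ω → ℝ) (r : ℝ) : Set (RandomPath Ω d) :=
  {φ | φ ∈ admissible μ ℱ T w 𝒮 ∧ (∀ t < T, ∀ᵐ ω ∂μ, ‖φ t ω‖ ≤ G t ω) ∧
    (r : EReal) ≤ worstCaseUtility μ T w 𝒮 U φ}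

theorem mem_admissible_iff :
    φ ∈ admissible μ ℱ T w 𝒮 ↔ ∀ S ∈ 𝒮, φ ∈ feasible μ ℱ T w S := by
  simp [admissible]

theorem le_worstCaseUtility_iff {e : EReal} : e ≤ worstCaseUtility μ T w 𝒮 U φ ↔
    ∀ S ∈ 𝒮, e ≤ expectation μ (fun ω => U (wealth w S φ T ω)) := by
  simp [worstCaseUtility]

theorem expectation_congr_ae {X Y : Ω → EReal} (h : X =ᵐ[μ] Y) :
    expectation μ X = expectation μ Y := by
  have h1 := lintegral_congr_ae (h.fun_comp EReal.toENNReal)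
  have h2 := lintegral_congr_ae (h.fun_comp fun x => (-x).toENNReal)
  simp only [Function.comp_apply] at h1 h2
  rw [expectation, expectation, h1, h2]

/-- The terminal wealth of a strategy dominated by `G` is dominated by this random variable. -/
def absWealthBound (T : ℕ) (w : ℝ) (S : RandomPath Ω d) (G : ℕ → Ω → ℝ) (ω : Ω) : ℝ :=
  |w| + ∑ s ∈ Finset.range T, G s ω * ‖priceChange S s ω‖

theorem norm_wealth_le (hG : ∀ t < T, ∀ᵐ ω ∂μ, ‖φ t ω‖ ≤ G t ω) :
    ∀ᵐ ω ∂μ, ‖wealth w S φ T ω‖ ≤ absWealthBound T w S G ω := by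
  have : ∀ᵐ ω ∂μ, ∀ s ∈ Finset.range T, ‖φ s ω‖ ≤ G s ω :=
    (Finset.eventually_all _).2 fun s hs => hG s (Finset.mem_range.1 hs)
  filter_upwards [this] with ω hω
  refine (norm_add_le _ _).trans (add_le_add le_rfl ((norm_sum_le _ _).trans ?_))
  refine Finset.sum_le_sum fun s hs => (norm_inner_le_norm _ _).trans ?_
  exact mul_le_mul_of_nonneg_right (hω s hs) (norm_nonneg _)

variable [IsFiniteMeasure μ]

theorem integrable_absWealthBound (hG : ∀ t < T, MemLp (G t) 2 μ)
    (hS : ∀ t < T, MemLp (fun ω => ‖priceChange S t ω‖) 2 μ) :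
    Integrable (absWealthBound T w S G) μ := by
  refine (integrable_const |w|).add (integrable_finsetSum _ fun s hs => ?_)
  exact (hG s (Finset.mem_range.1 hs)).integrable_mul (hS s (Finset.mem_range.1 hs))

theorem integrable_wealth (hadapted : ∀ t ≤ T, Measurable[ℱ t] (S t))
    (hG2 : ∀ t < T, MemLp (G t) 2 μ) (hS2 : ∀ t < T, MemLp (fun ω => ‖priceChange S t ω‖) 2 μ)
    (hφ : φ ∈ strategies ℱ T) (hG : ∀ t < T, ∀ᵐ ω ∂μ, ‖φ t ω‖ ≤ G t ω) :
    Integrable (wealth w S φ T) μ :=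
  (integrable_absWealthBound hG2 hS2).mono'
    (measurable_wealth' hadapted hφ le_rfl).aestronglyMeasurable (norm_wealth_le hG)

/-- The bound `G` supplies an integrable majorant of the terminal wealth in each model, as
`le_expectation_of_tendsto` requires; the other constraints are closed pointwise. -/
theorem mem_candidates_of_tendsto (hU : IsUtility U) {C : ℝ} (hC0 : 0 ≤ C)
    (hC : ∀ x, U x ≤ ((C * (1 + x) : ℝ) : EReal))
    (hnull : ∀ N : Set Ω, μ N = 0 → MeasurableSet[ℱ 0] N)
    (hadapted : ∀ S ∈ 𝒮, ∀ t ≤ T, Measurable[ℱ t] (S t))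
    (hG2 : ∀ t < T, MemLp (G t) 2 μ)
    (hS2 : ∀ S ∈ 𝒮, ∀ t < T, MemLp (fun ω => ‖priceChange S t ω‖) 2 μ)
    {Φ : ℕ → RandomPath Ω d} (hΦ : ∀ n, Φ n ∈ candidates μ ℱ T w 𝒮 U G r)
    (hlim : ∀ t < T, ∀ᵐ ω ∂μ, Tendsto (fun n => Φ n t ω) atTop (𝓝 (φ t ω))) :
    φ ∈ candidates μ ℱ T w 𝒮 U G r := by
  have hadm : ∀ n, ∀ S ∈ 𝒮, Φ n ∈ feasible μ ℱ T w S := fun n => mem_admissible_iff.1 (hΦ n).1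
  have hstrat : ∀ S ∈ 𝒮, φ ∈ strategies ℱ T := fun S hS t ht =>
    measurable_of_ae_tendsto (ℱ.le t) (fun N hN => ℱ.mono (Nat.zero_le t) N (hnull N hN))
      (fun n => (hadm n S hS).1 t ht) (hlim t ht)
  have hG : ∀ t < T, ∀ᵐ ω ∂μ, ‖φ t ω‖ ≤ G t ω := fun t ht => by
    filter_upwards [hlim t ht, ae_all_iff.2 fun n => (hΦ n).2.1 t ht] with ω h1 h2
    exact le_of_tendsto' h1.norm h2
  have hw : ∀ S : RandomPath Ω d, ∀ t ≤ T, ∀ᵐ ω ∂μ,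
      Tendsto (fun n => wealth w S (Φ n) t ω) atTop (𝓝 (wealth w S φ t ω)) := fun S t ht => by
    have : ∀ᵐ ω ∂μ, ∀ s ∈ Finset.range t, Tendsto (fun n => Φ n s ω) atTop (𝓝 (φ s ω)) :=
      (Finset.eventually_all _).2 fun s hs => hlim s ((Finset.mem_range.1 hs).trans_le ht)
    filter_upwards [this] with ω hω
    exact (tendsto_finsetSum _ fun s hs => (hω s hs).inner tendsto_const_nhds).const_add w
  refine ⟨mem_admissible_iff.2 fun S hS => ⟨hstrat S hS, fun t ht => ?_⟩, hG,
    le_worstCaseUtility_iff.2 fun S hS => ?_⟩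
  · filter_upwards [hw S t ht, ae_all_iff.2 fun n => (hadm n S hS).2 t ht] with ω h1 h2
    exact ge_of_tendsto' h1 h2
  · exact le_expectation_of_tendsto hU hC0 hC
      (fun n => integrable_wealth (hadapted S hS) hG2 (hS2 S hS) (hadm n S hS).1 (hΦ n).2.1)
      (fun n => (hadm n S hS).2 T le_rfl) (integrable_absWealthBound hG2 (hS2 S hS))
      (fun n => norm_wealth_le (hΦ n).2.1)
      (integrable_wealth (hadapted S hS) hG2 (hS2 S hS) (hstrat S hS) hG) (hw S T le_rfl)
      (fun n => le_worstCaseUtility_iff.1 (hΦ n).2.2 S hS)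

theorem mem_candidates_convex (hU : IsUtility U) {C : ℝ} (hC0 : 0 ≤ C)
    (hC : ∀ x, U x ≤ ((C * (1 + x) : ℝ) : EReal))
    (hadapted : ∀ S ∈ 𝒮, ∀ t ≤ T, Measurable[ℱ t] (S t))
    (hG2 : ∀ t < T, MemLp (G t) 2 μ)
    (hS2 : ∀ S ∈ 𝒮, ∀ t < T, MemLp (fun ω => ‖priceChange S t ω‖) 2 μ)
    (hφ : φ ∈ candidates μ ℱ T w 𝒮 U G r) (hψ : ψ ∈ candidates μ ℱ T w 𝒮 U G r) {a b : ℝ}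
    (ha : 0 < a) (hb : 0 < b) (hab : a + b = 1) :
    (fun t ω => a • φ t ω + b • ψ t ω) ∈ candidates μ ℱ T w 𝒮 U G r := by
  have hφa := mem_admissible_iff.1 hφ.1
  have hψa := mem_admissible_iff.1 hψ.1
  have hw : ∀ (S : RandomPath Ω d) t ω, wealth w S (fun t ω => a • φ t ω + b • ψ t ω) t ω =
      a * wealth w S φ t ω + b * wealth w S ψ t ω := fun S t ω => by
    simp only [wealth, inner_add_left, inner_smul_left, Finset.sum_add_distrib, ← Finset.mul_sum,
      RCLike.conj_to_real]
    linear_combination (-w) * hab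
  refine ⟨mem_admissible_iff.2 fun S hS => ⟨fun t ht => ?_, fun t ht => ?_⟩, fun t ht => ?_,
    le_worstCaseUtility_iff.2 fun S hS => ?_⟩
  · exact (((hφa S hS).1 t ht).const_smul a).add (((hψa S hS).1 t ht).const_smul b)
  · filter_upwards [(hφa S hS).2 t ht, (hψa S hS).2 t ht] with ω h1 h2
    rw [hw]
    positivity
  · filter_upwards [hφ.2.1 t ht, hψ.2.1 t ht] with ω h1 h2
    calc ‖a • φ t ω + b • ψ t ω‖ ≤ a * ‖φ t ω‖ + b * ‖ψ t ω‖ := by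
          refine (norm_add_le _ _).trans_eq ?_
          rw [norm_smul, norm_smul, Real.norm_of_nonneg ha.le, Real.norm_of_nonneg hb.le]
      _ ≤ a * G t ω + b * G t ω := by gcongr
      _ = G t ω := by rw [← add_mul, hab, one_mul]
  · simp_rw [hw]
    exact le_expectation_convex hU hC0 hC
      (integrable_wealth (hadapted S hS) hG2 (hS2 S hS) (hφa S hS).1 hφ.2.1)
      ((hφa S hS).2 T le_rfl)
      (integrable_wealth (hadapted S hS) hG2 (hS2 S hS) (hψa S hS).1 hψ.2.1)
      ((hψa S hS).2 T le_rfl) ha hb hab (le_worstCaseUtility_iff.1 hφ.2.2 S hS)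
      (le_worstCaseUtility_iff.1 hψ.2.2 S hS)

/-- Portfolios for the first `T` periods, as a vector-valued function, made into a strategy. -/
def toPath (f : Ω → PiLp 2 (fun _ : Fin T => EuclideanSpace ℝ (Fin d))) : RandomPath Ω d :=
  fun t ω => if h : t < T then f ω ⟨t, h⟩ else 0

theorem toPath_of_lt {f : Ω → PiLp 2 (fun _ : Fin T => EuclideanSpace ℝ (Fin d))} {t : ℕ}
    (h : t < T) (ω : Ω) : toPath f t ω = f ω ⟨t, h⟩ := by
  simp [toPath, h]

theorem norm_piLp_le_sum (v : PiLp 2 (fun _ : Fin T => EuclideanSpace ℝ (Fin d))) :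
    ‖v‖ ≤ ∑ t, ‖v t‖ := by
  rw [PiLp.norm_eq_of_L2]
  refine Real.sqrt_le_iff.2 ⟨Finset.sum_nonneg fun _ _ => norm_nonneg _, ?_⟩
  exact Finset.sum_sq_le_sq_sum_of_nonneg fun _ _ => norm_nonneg _

/-- A compactness argument: if for a strictly increasing sequence of levels there are strategies
that are dominated by `G` and reach these levels, then one strategy reaches all of them. -/
theorem exists_mem_candidates (hU : IsUtility U) {C : ℝ} (hC0 : 0 ≤ C)
    (hC : ∀ x, U x ≤ ((C * (1 + x) : ℝ) : EReal))
    (hnull : ∀ N : Set Ω, μ N = 0 → MeasurableSet[ℱ 0] N) (h𝒮 : 𝒮.Nonempty)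
    (hadapted : ∀ S ∈ 𝒮, ∀ t ≤ T, Measurable[ℱ t] (S t))
    (hG2 : ∀ t < T, MemLp (G t) 2 μ)
    (hS2 : ∀ S ∈ 𝒮, ∀ t < T, MemLp (fun ω => ‖priceChange S t ω‖) 2 μ)
    {ρ : ℕ → ℝ} (hρ : Monotone ρ) (hne : ∀ n, (candidates μ ℱ T w 𝒮 U G (ρ n)).Nonempty) :
    ∃ φ, ∀ n, φ ∈ candidates μ ℱ T w 𝒮 U G (ρ n) := by
  -- Elements of `Lp` are classes, so invariance under almost sure modification is needed; a
  -- constant sequence yields it.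
  have hcongr : ∀ {r : ℝ} {φ ψ : RandomPath Ω d}, φ ∈ candidates μ ℱ T w 𝒮 U G r →
      (∀ t < T, ∀ᵐ ω ∂μ, φ t ω = ψ t ω) → ψ ∈ candidates μ ℱ T w 𝒮 U G r := fun hφ h =>
    mem_candidates_of_tendsto hU hC0 hC hnull hadapted hG2 hS2 (fun _ => hφ) fun t ht => by
      filter_upwards [h t ht] with ω hω
      rw [hω]
      exact tendsto_const_nhds
  let H := Lp (PiLp 2 (fun _ : Fin T => EuclideanSpace ℝ (Fin d))) 2 μ
  let K : ℕ → Set H := fun n => {f | toPath f ∈ candidates μ ℱ T w 𝒮 U G (ρ n)}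
  have hg : MemLp (fun ω => ∑ t : Fin T, G t ω) 2 μ := memLp_finsetSum _ fun t _ => hG2 t t.2
  have hsum : ∀ (f : Ω → PiLp 2 (fun _ : Fin T => EuclideanSpace ℝ (Fin d))),
      (∀ t : Fin T, ∀ᵐ ω ∂μ, ‖f ω t‖ ≤ G t ω) → ∀ᵐ ω ∂μ, ‖f ω‖ ≤ ∑ t : Fin T, G t ω := fun f hf => by
    filter_upwards [ae_all_iff.2 hf] with ω hω
    exact (norm_piLp_le_sum _).trans (Finset.sum_le_sum fun t _ => hω t)
  have hinter : (⋂ n, K n).Nonempty := by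
    refine nonempty_iInter_of_convex_of_bounded (R := ‖hg.toLp‖) ?_ ?_ ?_ ?_ ?_
    · intro n m hnm f hf
      exact ⟨hf.1, hf.2.1, (EReal.coe_le_coe_iff.2 (hρ hnm)).trans hf.2.2⟩
    · intro n
      rw [convex_iff_forall_pos]
      intro f hf g hg a b ha hb hab
      refine hcongr (mem_candidates_convex hU hC0 hC hadapted hG2 hS2 hf hg ha hb hab)
        fun t ht => ?_
      filter_upwards [Lp.coeFn_add (a • f) (b • g), Lp.coeFn_smul a f, Lp.coeFn_smul b g]
        with ω h1 h2 h3
      simp only [toPath_of_lt ht, h1, Pi.add_apply, h2, h3, Pi.smul_apply, PiLp.add_apply,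
        PiLp.smul_apply]
    · intro n
      refine IsSeqClosed.isClosed fun f g hf hlim => ?_
      -- L² convergence gives almost sure convergence along a subsequence, which suffices for
      -- closedness.
      obtain ⟨ns, -, hns⟩ := (tendstoInMeasure_of_tendsto_Lp hlim).exists_seq_tendsto_ae
      refine mem_candidates_of_tendsto hU hC0 hC hnull hadapted hG2 hS2 (fun k => hf (ns k))
        fun t ht => ?_
      filter_upwards [hns] with ω hω
      simp only [toPath_of_lt ht]
      exact ((PiLp.continuous_apply 2 _ _).tendsto _).comp hω
    · intro n
      obtain ⟨φ, hφ⟩ := hne n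
      obtain ⟨S, hS⟩ := h𝒮
      have hφm : ∀ t < T, Measurable (φ t) := fun t ht =>
        ((mem_admissible_iff.1 hφ.1 S hS).1 t ht).mono (ℱ.le t) le_rfl
      set F : Ω → PiLp 2 (fun _ : Fin T => EuclideanSpace ℝ (Fin d)) :=
        fun ω => WithLp.toLp 2 fun t : Fin T => φ t ω with hF
      have hFm : Measurable F :=
        (WithLp.measurable_toLp 2 _).comp (measurable_pi_lambda _ fun t => hφm t t.2)
      have hFL : MemLp F 2 μ := hg.of_le hFm.aestronglyMeasurable (by
        filter_upwards [hsum F fun t => hφ.2.1 t t.2] with ω hω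
        exact hω.trans (le_abs_self _))
      refine ⟨hFL.toLp, hcongr hφ fun t ht => ?_⟩
      filter_upwards [hFL.coeFn_toLp] with ω hω
      rw [toPath_of_lt ht, hω]
    · intro n f hf
      refine Lp.norm_le_norm_of_ae_le ?_
      have : ∀ᵐ ω ∂μ, ‖f ω‖ ≤ ∑ t : Fin T, G t ω := by
        refine hsum f fun t => ?_
        filter_upwards [hf.2.1 t t.2] with ω hω
        rwa [toPath_of_lt t.2] at hω
      filter_upwards [this, hg.coeFn_toLp] with ω h1 h2
      rw [h2]
      exact h1.trans (le_abs_self _)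
  obtain ⟨f, hf⟩ := hinter
  exact ⟨toPath f, fun n => Set.mem_iInter.1 hf n⟩

end Candidates

/-! ### Dominated representatives and finiteness from below. -/

section Value

variable {Ω : Type*} {mΩ : MeasurableSpace Ω} {d T : ℕ} {μ : Measure Ω} {ℱ : Filtration ℕ mΩ}
  {𝒮 : Set (RandomPath Ω d)} {S' φ : RandomPath Ω d} {w : ℝ} {U : ℝ → EReal}

/-- The portfolio bound that results from the wealth bound. -/
def portfolioBound (w : ℝ) (S : RandomPath Ω d) (b : ℕ → Ω → ℝ) (t : ℕ) (ω : Ω) : ℝ :=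
  b t ω * wealthBound w S b t ω

theorem exists_dominated_strategy [IsFiniteMeasure μ]
    (hadapted : ∀ S ∈ 𝒮, ∀ t ≤ T, Measurable[ℱ t] (S t))
    (hS' : S' ∈ arbitrageFreeModels μ ℱ T w 𝒮) (hw : 0 ≤ w) {β κ : ℕ → Ω → ℝ}
    (hβ : ∀ t < T, IsArbitrageBound μ ℱ S' t (β t) (κ t)) (hφ : φ ∈ admissible μ ℱ T w 𝒮) :
    ∃ ξ ∈ admissible μ ℱ T w 𝒮,
      (∀ t < T, ∀ᵐ ω ∂μ, ‖ξ t ω‖ ≤ portfolioBound w S' (fun t ω => 1 / β t ω) t ω) ∧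
      (∀ᵐ ω ∂μ, wealth w S' ξ T ω ≤ wealthBound w S' (fun t ω => 1 / β t ω) T ω) ∧
      worstCaseUtility μ T w 𝒮 U ξ = worstCaseUtility μ T w 𝒮 U φ := by
  rw [mem_admissible_iff] at hφ
  obtain ⟨ξ, hξ, hspan, hwealth⟩ :=
    exists_strategy_mem_condSpan hadapted hS' hw (hφ S' hS'.1).1
  have hfeas : ∀ S ∈ 𝒮, ξ ∈ feasible μ ℱ T w S := fun S hS => ⟨hξ, fun t ht => by
    filter_upwards [(hφ S hS).2 t ht, hwealth S hS t ht] with ω h1 h2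
    rwa [h2]⟩
  have hall : ∀ᵐ ω ∂μ, ∀ t ∈ Finset.range T, 0 < β t ω ∧ β t ω * ‖ξ t ω‖ ≤ wealth w S' ξ t ω :=
    (Finset.eventually_all _).2 fun t ht =>
      (hβ t (Finset.mem_range.1 ht)).2.2.1.and ((hβ t (Finset.mem_range.1 ht)).mul_norm_le_wealth
        (hadapted S' hS'.1) (Finset.mem_range.1 ht) (hfeas S' hS'.1)
        (hspan t (Finset.mem_range.1 ht)))
  have hpos : ∀ᵐ ω ∂μ, ∀ t < T, 0 ≤ 1 / β t ω := by
    filter_upwards [hall] with ω hω t ht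
    exact (one_div_pos.2 (hω t (Finset.mem_range.2 ht)).1).le
  have hle : ∀ᵐ ω ∂μ, ∀ t < T, ‖ξ t ω‖ ≤ 1 / β t ω * wealth w S' ξ t ω := by
    filter_upwards [hall] with ω hω t ht
    obtain ⟨h1, h2⟩ := hω t (Finset.mem_range.2 ht)
    rwa [one_div, ← div_eq_inv_mul, le_div_iff₀' h1]
  refine ⟨ξ, mem_admissible_iff.2 hfeas, fun t ht => ?_, ?_, ?_⟩
  · filter_upwards [hpos, hle] with ω h1 h2
    refine (h2 t ht).trans (mul_le_mul_of_nonneg_left ?_ (h1 t ht))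
    exact wealth_le_wealthBound (fun s hs => h1 s (hs.trans ht)) (fun s hs => h2 s (hs.trans ht))
  · filter_upwards [hpos, hle] with ω h1 h2
    exact wealth_le_wealthBound h1 h2
  · refine iInf_congr fun S => iInf_congr fun hS => expectation_congr_ae ?_
    filter_upwards [hwealth S hS T le_rfl] with ω hω
    rw [hω]

/-- The zero strategy keeps the wealth at `w` in every model. -/
theorem bot_lt_robustValue [IsFiniteMeasure μ] (hw : 0 ≤ w) (hU : IsUtility U) (hUw : U w ≠ ⊥) :
    ⊥ < robustValue μ ℱ T w 𝒮 U := by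
  have hwealth : ∀ (S : RandomPath Ω d) t ω, wealth w S 0 t ω = w := by simp [wealth]
  have hadm : (0 : RandomPath Ω d) ∈ admissible μ ℱ T w 𝒮 := mem_admissible_iff.2 fun S _ =>
    ⟨fun _ _ => measurable_const, fun t _ => ae_of_all _ fun ω => by rwa [hwealth]⟩
  have h1 : expectation μ (fun _ => U w) ≤ worstCaseUtility μ T w 𝒮 U 0 :=
    le_worstCaseUtility_iff.2 fun S _ => by simp_rw [hwealth]; exact le_rfl
  refine lt_of_lt_of_le ?_ (h1.trans (le_iSup₂_of_le 0 hadm le_rfl))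
  obtain ⟨u, hu⟩ := (hU.eq_bot_or_coe w).resolve_left hUw
  have hP : ∫⁻ _, (U w).toENNReal ∂μ ≠ ∞ := by
    rw [lintegral_const, hu, EReal.toENNReal_of_ne_top (EReal.coe_ne_top _)]
    exact ENNReal.mul_ne_top ENNReal.ofReal_ne_top (measure_ne_top _ _)
  have hN : ∫⁻ _, (-U w).toENNReal ∂μ ≠ ∞ := by
    rw [lintegral_const, hu, ← EReal.coe_neg, EReal.toENNReal_of_ne_top (EReal.coe_ne_top _)]
    exact ENNReal.mul_ne_top ENNReal.ofReal_ne_top (measure_ne_top _ _)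
  rw [expectation, ← EReal.coe_ennreal_toReal hP, ← EReal.coe_ennreal_toReal hN, ← EReal.coe_sub]
  exact EReal.bot_lt_coe _

end Value

end RobustUtility

end

/-! ### Existence of an optimal strategy. -/

theorem mainTheorem2 {Ω : Type*} {mΩ : MeasurableSpace Ω} (μ : Measure Ω) [IsProbabilityMeasure μ]
    (d T : ℕ) (ℱ : Filtration ℕ mΩ)
    (hnull : ∀ N : Set Ω, μ N = 0 → MeasurableSet[ℱ 0] N)
    (𝒮 : Set (RobustUtility.RandomPath Ω d))
    (hadapted : ∀ S ∈ 𝒮, ∀ t ≤ T, Measurable[ℱ t] (S t))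
    (U : ℝ → EReal) (hU : RobustUtility.IsUtility U)
    (hdom : interior (RobustUtility.effDomain U) = Set.Ioi 0)
    (w : ℝ) (hw : 0 < w)
    (hmoments : ∀ S ∈ 𝒮, ∀ t < T,
      (fun ω => ‖RobustUtility.priceChange S t ω‖) ∈ RobustUtility.finiteMoments μ (ℱ T))
    (hNA : ∃ S' ∈ RobustUtility.arbitrageFreeModels μ ℱ T w 𝒮, ∀ t < T, ∃ β κ : Ω → ℝ,
      RobustUtility.IsArbitrageBound μ ℱ S' t β κ ∧
        (fun ω => 1 / β ω) ∈ RobustUtility.finiteMoments μ (ℱ T)) :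
    ∃ φ ∈ RobustUtility.admissible μ ℱ T w 𝒮,
      RobustUtility.robustValue μ ℱ T w 𝒮 U = RobustUtility.worstCaseUtility μ T w 𝒮 U φ ∧
      ⊥ < RobustUtility.robustValue μ ℱ T w 𝒮 U ∧
      RobustUtility.robustValue μ ℱ T w 𝒮 U < ⊤ := by
  open RobustUtility Filter Topology in
  obtain ⟨S', hS', hbound⟩ := hNA
  have hchoose : ∀ t, ∃ β κ : Ω → ℝ, t < T → IsArbitrageBound μ ℱ S' t β κ ∧
      (fun ω => 1 / β ω) ∈ finiteMoments μ (ℱ T) := fun t => by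
    by_cases ht : t < T
    · obtain ⟨β, κ, h⟩ := hbound t ht
      exact ⟨β, κ, fun _ => h⟩
    · exact ⟨0, 0, fun h => absurd h ht⟩
  choose β κ hβκ using hchoose
  obtain ⟨C, hC0, hC⟩ := hU.exists_le_linear hdom
  have hSp : ∀ S ∈ 𝒮, ∀ t < T, ∀ p : ENNReal, p ≠ ⊤ →
      MemLp (fun ω => ‖priceChange S t ω‖) p μ := fun S hS t ht p hp =>
    memLp_of_mem_finiteMoments (ℱ.le T) (hmoments S hS t ht) hp
  have hβp : ∀ t < T, ∀ p : ENNReal, p ≠ ⊤ → MemLp (fun ω => 1 / β t ω) p μ := fun t ht p hp =>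
    memLp_of_mem_finiteMoments (ℱ.le T) (hβκ t ht).2 hp
  have hWB : ∀ t ≤ T, ∀ p : ENNReal, p ≠ ⊤ →
      MemLp (wealthBound w S' (fun t ω => 1 / β t ω) t) p μ := fun t ht p hp =>
    memLp_wealthBound (fun s hs => hβp s (hs.trans_le ht))
      (fun s hs => hSp S' hS'.1 s (hs.trans_le ht)) hp
  have hG2 : ∀ t < T, MemLp (portfolioBound w S' (fun t ω => 1 / β t ω) t) 2 μ := fun t ht =>
    memLp_mul_of_forall (hβp t ht) (hWB t ht.le) ENNReal.ofNat_ne_top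
  have hS2 : ∀ S ∈ 𝒮, ∀ t < T, MemLp (fun ω => ‖priceChange S t ω‖) 2 μ := fun S hS t ht =>
    hSp S hS t ht 2 ENNReal.ofNat_ne_top
  have hdominated := fun φ => exists_dominated_strategy (U := U) (φ := φ) hadapted hS' hw.le
    (fun t ht => (hβκ t ht).1)
  have hWBi := memLp_one_iff_integrable.1 (hWB T le_rfl 1 ENNReal.one_ne_top)
  have htop : robustValue μ ℱ T w 𝒮 U < ⊤ := by
    refine lt_of_le_of_lt (iSup₂_le fun φ hφ => ?_)
      (EReal.coe_lt_top (∫ ω, C * (1 + wealthBound w S' (fun t ω => 1 / β t ω) T ω) ∂μ))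
    obtain ⟨ξ, hξ, hξG, hξW, heq⟩ := hdominated φ hφ
    rw [← heq]
    have hfeas := mem_admissible_iff.1 hξ S' hS'.1
    have hi := integrable_wealth (w := w) (hadapted S' hS'.1) hG2 (hS2 S' hS'.1) hfeas.1 hξG
    -- The infimum over models is bounded by its value at `S'`, the only model for which the wealth
    -- bound is available.
    refine (le_worstCaseUtility_iff.1 le_rfl S' hS'.1).trans
      ((expectation_le hU hC0 hC hi (hfeas.2 T le_rfl)).trans (EReal.coe_le_coe_iff.2 ?_))
    refine integral_mono_ae (((integrable_const 1).add hi).const_mul C)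
      (((integrable_const 1).add hWBi).const_mul C) ?_
    filter_upwards [hξW] with ω hω
    gcongr
  have hbot := bot_lt_robustValue (μ := μ) (ℱ := ℱ) (T := T) (𝒮 := 𝒮) hw.le hU
    (IsUtility.ne_bot_of_pos hdom hw)
  -- Levels strictly between `⊥` and the value are real, and each is exceeded by some admissible
  -- strategy, hence by a dominated one.
  obtain ⟨r, hr, hrmem, hrlim⟩ := exists_seq_strictMono_tendsto' hbot
  have hcoe : ∀ n, ((r n).toReal : EReal) = r n := fun n =>
    EReal.coe_toReal ((hrmem n).2.trans htop).ne (hrmem n).1.ne'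
  obtain ⟨φ, hφ⟩ := exists_mem_candidates (ρ := fun n => (r n).toReal) (w := w) hU hC0 hC hnull
    ⟨S', hS'.1⟩ hadapted hG2 hS2 (fun n m hnm => by
      rw [← EReal.coe_le_coe_iff, hcoe, hcoe]
      exact hr.monotone hnm) (fun n => by
      obtain ⟨φ, hφ⟩ := lt_iSup_iff.1 (hrmem n).2
      obtain ⟨hφa, hφr⟩ := lt_iSup_iff.1 hφ
      obtain ⟨ξ, hξ, hξG, -, heq⟩ := hdominated φ hφa
      exact ⟨ξ, hξ, hξG, by rw [hcoe, heq]; exact hφr.le⟩)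
  refine ⟨φ, (hφ 0).1, le_antisymm ?_ (le_iSup₂_of_le φ (hφ 0).1 le_rfl), hbot, htop⟩
  exact le_of_tendsto' hrlim fun n => by
    rw [← hcoe n]
    exact (hφ n).2.2
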